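/- **Notation.** For $0<k<1$ let $F(\varphi,k)=\int_0^\varphi (1-k^2\sin^2 t)^{-1/2}\,dt$, $K(k)=F(\pi/2,k)$, let $\mathrm{am}(\cdot;k)$ be the inverse of $F(\cdot,k):\mathbb R\to\mathbb R$, $\mathrm{sn}=\sin\circ\mathrm{am}$, $\mathrm{dn}=\sqrt{1-k^2\mathrm{sn}^2}$, and let $\mathrm{dn}^{-1}(\cdot;k)$ be the inverse of the decreasing bijection $\mathrm{dn}(\cdot;k):[0,K(k)]\to[\sqrt{1-k^2},1]$. For $\omega>Z^2/4$ put $$\theta(\omega,Z)=-\tfrac{\sqrt2}{4}|Z|+\sqrt{\omega-\tfrac{Z^2}{8}},\qquad \lambda(\omega,Z)=\tfrac{\sqrt2}{4}|Z|+\sqrt{\omega-\tfrac{Z^2}{8}},$$ and, for $\eta\in(0,\theta(\omega,Z))$, $$k^2(\eta,\omega)=\frac{2\omega-2\eta^2}{2\omega-\eta^2},\qquad \Phi^2(\eta,\omega,Z)=\frac{(2\omega-\frac{Z^2}{2})+\sqrt{(2\omega-\frac{Z^2}{2})^2-4\eta^2(2\omega-\eta^2)}}{2}\quad(\Phi>0),$$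 $$a(\eta,\omega,Z)=\mathrm{dn}^{-1}\Big(\frac{\Phi(\eta,\omega,Z)}{\sqrt{2\omega-\eta^2}};k(\eta,\omega)\Big),\qquad T_-(\eta,\omega,Z)=\frac{2\sqrt2}{\sqrt{2\omega-\eta^2}}\,[K(k(\eta,\omega))-a(\eta,\omega,Z)].$$ For $Z\neq0$ let $$T_0(\omega,Z)=\frac{2\sqrt2}{\lambda(\omega,Z)}[K(k_0)-a_0],\quad k_0^2=\frac{\sqrt2|Z|\sqrt{\omega-Z^2/8}}{\lambda^2(\omega,Z)},\quad a_0=\mathrm{dn}^{-1}\Big(\frac{\sqrt{\omega-Z^2/4}}{\lambda(\omega,Z)};k_0\Big).$$ Given $L>0$ and $\eta\in(0,\theta(\omega,Z))$, the dnoidal peak $\phi(\cdot;\eta,\omega,Z)$ is the $2L$-periodic extension to $\mathbb R$ of $\xi\mapsto \eta_1\,\mathrm{dn}\big(\tfrac{\eta_1}{\sqrt2}|\xi|+a(\eta,\omega,Z);k(\eta,\omega)\big)$, $\xi\in[-L,L]$, where $\eta_1=\sqrt{2\omega-\eta^2}$. **Theorem 5.3.** Let $L>0$, $Z_0>0$,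 and let $\omega_0>\frac{Z_0^2}{4}$ satisfy $T_0(\omega_0,Z_0)<2L$ and $\omega_0>\frac{\pi^2}{2L^2}$. Then there is a unique $\eta_{2,0}\in(0,\theta(\omega_0,Z_0))$ with $T_-(\eta_{2,0},\omega_0,Z_0)=2L$, and there are functions $\mu$ of $Z\ge 0$ and $\Lambda$ of $(\omega,Z)$ with $\Lambda(\omega_0,Z_0)=\eta_{2,0}$ such that: 1. (Frequency range.) $\mu(0)=\frac{\pi^2}{2L^2}$, and for $\omega>0$ the equation $T_-(\eta,\omega,0)=2L$ has a solution $\eta\in(0,\theta(\omega,0))$ if and only if $\omega>\mu(0)$. For every $Z>0$: $\mu(Z)>\frac{Z^2}{4}$, $\mu(Z)\ge\frac{\pi^2}{2L^2}$, and $\omega>\mu(Z)$ if and only if $\omega>\frac{Z^2}{4}$, $\omega>\frac{\pi^2}{2L^2}$ and $T_0(\omega,Z)<2L$. 2. (Smooth solution map.) At every $(\omega,Z)$ with $Z>0$, $\omega>\mu(Z)$, the function $\Lambda$ is $C^\infty$, and $\eta=\Lambda(\omega,Z)$ is the unique solution in $(0,\theta(\omega,Z))$ of $T_-(\eta,\omega,Z)=2L$.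 Moreover, for every $m$ with $\mu(Z_0)<m<\omega_0$ (so $m>\frac{Z_0^2}{4}$ and $m>\frac{\pi^2}{2L^2}$) there are an open interval $I\subset(0,\infty)$ around $Z_0$ and an open interval $N$ around $\eta_{2,0}$ such that every $(\omega,Z)$ in the rectangle $(m,\infty)\times I$ satisfies $\omega>\mu(Z)$ and $\Lambda(\omega,Z)\in N$. 3. (Dnoidal peaks.) For $Z>0$ and $\omega>\mu(Z)$ the dnoidal peak $\phi_{\omega,Z}=\phi(\cdot;\Lambda(\omega,Z),\omega,Z)$ is positive, even, $2L$-periodic, continuous on $\mathbb R$ and $C^2$ on $\mathbb R\setminus 2L\mathbb Z$, where it satisfies $-\phi''+\omega\phi=\phi^3$; the one-sided limits $\phi'(0\pm)$ exist and $\phi'(0+)-\phi'(0-)=-Z\phi(0)$. For each fixed $\omega$, the map $Z\mapsto\phi_{\omega,Z}\in H^1_{per}([-L,L])$ is real-analytic on $\{Z>0:\mu(Z)<\omega\}$. -/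

import Mathlib

open Set Filter Topology MeasureTheory

namespace DnoidalPeak

noncomputable section

/-! Elliptic integrals and Jacobian elliptic functions with modulus `k` (meant for `0 ≤ k < 1`). -/

/-- Normal elliptic integral of the first kind `F(φ, k)`. -/
def ellF (φ k : ℝ) : ℝ := ∫ t in (0 : ℝ)..φ, 1 / √(1 - k ^ 2 * Real.sin t ^ 2)

/-- Complete elliptic integral of the first kind `K(k) = F(π/2, k)`. -/
def ellK (k : ℝ) : ℝ := ellF (Real.pi / 2) k

/-- Jacobi amplitude: the inverse of `φ ↦ F(φ, k)`, a strictly increasing bijection of `ℝ`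
for `0 ≤ k < 1`. -/
def am (u k : ℝ) : ℝ := Function.invFun (fun φ => ellF φ k) u

/-- The snoidal function. -/
def sn (u k : ℝ) : ℝ := Real.sin (am u k)

/-- The dnoidal function. -/
def dn (u k : ℝ) : ℝ := √(1 - k ^ 2 * sn u k ^ 2)

/-- The inverse `dn⁻¹(y; k) ∈ [0, K(k)]` of the decreasing bijection
`dn(·; k) : [0, K(k)] → [√(1 - k²), 1]` (for `0 < k < 1`). -/
def arcdn (y k : ℝ) : ℝ := Function.invFunOn (fun u => dn u k) (Icc 0 (ellK k)) y

/-! Parameters of the dnoidal peaks. -/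

/-- `θ(ω, Z)`, the upper end of the range of `η₂`. -/
def theta (ω Z : ℝ) : ℝ := -(√2 / 4) * |Z| + √(ω - Z ^ 2 / 8)

/-- `λ(ω, Z)`, the lower end of the range of `η₁`. -/
def lam (ω Z : ℝ) : ℝ := √2 / 4 * |Z| + √(ω - Z ^ 2 / 8)

/-- `η₁` as a function of `η = η₂` and `ω`. -/
def eta1 (η ω : ℝ) : ℝ := √(2 * ω - η ^ 2)

/-- The modulus, `k² = (2ω - 2η²) / (2ω - η²)`. -/
def modulus (η ω : ℝ) : ℝ := √((2 * ω - 2 * η ^ 2) / (2 * ω - η ^ 2))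

/-- `Φ(η, ω, Z)`, the value of the peak at its crest. -/
def crest (η ω Z : ℝ) : ℝ :=
  √(((2 * ω - Z ^ 2 / 2) + √((2 * ω - Z ^ 2 / 2) ^ 2 - 4 * η ^ 2 * (2 * ω - η ^ 2))) / 2)

/-- The shift `a(η, ω, Z)`. -/
def shift (η ω Z : ℝ) : ℝ := arcdn (crest η ω Z / eta1 η ω) (modulus η ω)

/-- The period function `T₋(η, ω, Z)`. -/
def Tminus (η ω Z : ℝ) : ℝ := 2 * √2 / eta1 η ω * (ellK (modulus η ω) - shift η ω Z)

/-- The limiting modulus `k₀(ω, Z)`. -/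
def modulus0 (ω Z : ℝ) : ℝ := √(√2 * |Z| * √(ω - Z ^ 2 / 8) / lam ω Z ^ 2)

/-- The limiting shift `a₀(ω, Z)`. -/
def shift0 (ω Z : ℝ) : ℝ := arcdn (√(ω - Z ^ 2 / 4) / lam ω Z) (modulus0 ω Z)

/-- The threshold `T₀(ω, Z)`. -/
def T0 (ω Z : ℝ) : ℝ := 2 * √2 / lam ω Z * (ellK (modulus0 ω Z) - shift0 ω Z)

/-- The dnoidal peak with parameter `η₂ = η`: it equals
`η₁ dn (η₁ |ξ| / √2 + a; k)` on `[-L, L]` and is extended to `ℝ` with period `2L`. -/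
def peak (L η ω Z ξ : ℝ) : ℝ :=
  eta1 η ω *
    dn (eta1 η ω / √2 * |ξ - 2 * L * (round (ξ / (2 * L)) : ℝ)| + shift η ω Z) (modulus η ω)

/-- The lattice `2L ℤ` where the defect sits. -/
def nodes (L : ℝ) : Set ℝ := range fun n : ℤ => 2 * (n : ℝ) * L

/-- `φ` is a positive `2L`-periodic solution of `-φ'' + ω φ - Z δ φ = φ³`, with the point defect
at the lattice `2L ℤ`. -/
structure IsPeriodicPeak (L ω Z : ℝ) (φ : ℝ → ℝ) : Prop where
  pos : ∀ x, 0 < φ x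
  periodic : ∀ x, φ (x + 2 * L) = φ x
  continuous : Continuous φ
  contDiffOn : ContDiffOn ℝ 2 φ (nodes L)ᶜ
  equation : ∀ x ∉ nodes L, -deriv (deriv φ) x + ω * φ x = φ x ^ 3
  jump : ∃ dp dm : ℝ, Tendsto (deriv φ) (𝓝[>] 0) (𝓝 dp) ∧ Tendsto (deriv φ) (𝓝[<] 0) (𝓝 dm) ∧
    dp - dm = -Z * φ 0

/-! The Sobolev space `H¹_per([-L, L])`. -/

/-- Lebesgue measure on one period. -/
abbrev periodMeasure (L : ℝ) : Measure ℝ := volume.restrict (Ioc (-L) L)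

/-- Complex `L²_per([-L, L])`. -/
abbrev L2per (L : ℝ) : Type := Lp ℂ 2 (periodMeasure L)

/-- `g` is the weak derivative of `f` in the sense of `2L`-periodic distributions. -/
def IsWeakPerDeriv (L : ℝ) (f g : ℝ → ℂ) : Prop :=
  ∀ ψ : ℝ → ℝ, ContDiff ℝ (⊤ : ℕ∞) ψ → Function.Periodic ψ (2 * L) →
    ∫ x, (deriv ψ x : ℝ) • f x ∂(periodMeasure L) = -∫ x, (ψ x : ℝ) • g x ∂(periodMeasure L)

theorem integrable_smul {L : ℝ} (f : L2per L) {ψ : ℝ → ℝ} (hψ : Continuous ψ) :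
    Integrable (fun x => (ψ x : ℝ) • (f x : ℂ)) (periodMeasure L) := by
  have hf : Integrable (fun x => (f x : ℂ)) (periodMeasure L) :=
    (Lp.memLp f).integrable (by norm_num)
  obtain ⟨C, hC⟩ := isCompact_Icc.exists_bound_of_continuousOn (s := Icc (-L) L) hψ.continuousOn
  refine hf.bdd_smul C hψ.aestronglyMeasurable ?_
  refine (ae_restrict_iff' measurableSet_Ioc).2 (Eventually.of_forall fun x hx => ?_)
  exact hC x (Ioc_subset_Icc_self hx)

/-- `H¹_per([-L, L])` as a real Hilbert space: the pairs `(f, f')` in `L² × L²` where `f'` is the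
weak periodic derivative of `f`, with the norm `(‖f‖² + ‖f'‖²)^(1/2)`. -/
def H1per (L : ℝ) : Submodule ℝ (WithLp 2 (L2per L × L2per L)) where
  carrier := {p | IsWeakPerDeriv L p.fst p.snd}
  zero_mem' := by
    intro ψ hψ _
    have h : ∀ χ : ℝ → ℝ, ∫ x, (χ x : ℝ) • ((0 : L2per L) x : ℂ) ∂(periodMeasure L) = 0 := by
      intro χ
      refine integral_eq_zero_of_ae ?_
      filter_upwards [Lp.coeFn_zero ℂ 2 (periodMeasure L)] with x hx
      rw [hx, Pi.zero_apply, smul_zero]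
    exact (h (deriv ψ)).trans (by rw [WithLp.zero_snd, h ψ, neg_zero])
  add_mem' := by
    intro p q hp hq ψ hψ hper
    have h : ∀ (f g : L2per L) (χ : ℝ → ℝ), Continuous χ →
        ∫ x, (χ x : ℝ) • ((f + g : L2per L) x : ℂ) ∂(periodMeasure L) =
          ∫ x, (χ x : ℝ) • (f x : ℂ) ∂(periodMeasure L) +
            ∫ x, (χ x : ℝ) • (g x : ℂ) ∂(periodMeasure L) := by
      intro f g χ hχ
      rw [← integral_add (integrable_smul f hχ) (integrable_smul g hχ)]
      refine integral_congr_ae ?_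
      filter_upwards [Lp.coeFn_add f g] with x hx
      rw [hx, Pi.add_apply, smul_add]
    have h1 := h p.fst q.fst (deriv ψ) (hψ.continuous_deriv (by simp))
    have h2 := h p.snd q.snd ψ hψ.continuous
    have h3 := hp ψ hψ hper
    have h4 := hq ψ hψ hper
    rw [WithLp.add_fst, WithLp.add_snd, h1, h2, h3, h4, neg_add]
  smul_mem' := by
    intro c p hp ψ hψ hper
    have h : ∀ (f : L2per L) (χ : ℝ → ℝ),
        ∫ x, (χ x : ℝ) • ((c • f : L2per L) x : ℂ) ∂(periodMeasure L) =
          c • ∫ x, (χ x : ℝ) • (f x : ℂ) ∂(periodMeasure L) := by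
      intro f χ
      rw [← integral_smul]
      refine integral_congr_ae ?_
      filter_upwards [Lp.coeFn_smul c f] with x hx
      simp only [hx, Pi.smul_apply]
      rw [smul_comm]
    have h3 := hp ψ hψ hper
    rw [WithLp.smul_fst, WithLp.smul_snd, h p.fst, h p.snd, h3, smul_neg]

/-- The element `u` of `H¹_per([-L, L])` is the class of the real function `φ`. -/
def Represents {L : ℝ} (u : H1per L) (φ : ℝ → ℝ) : Prop :=
  (fun ξ => ((u : WithLp 2 (L2per L × L2per L)).fst ξ : ℂ)) =ᵐ[periodMeasure L]
    fun ξ => (φ ξ : ℂ)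

end

end DnoidalPeak

/-! Write `p = η₁`, `q = η₂ = η`, `r = 2pq` and `s = p² + q² = 2ω`. Landen's substitution `sin σ =
(D - pq/D)/(p - q)`, where `D = p dn` is the value of the profile, removes the modulus: `T₋` is
`2√2` times the integral of `1/√(2r + (s - r) sin² σ)` from `-π/2` to `arcsin y`, with `y² = (s - r
- Z²/2)/(s - r)` (`ellK_sub_arcdn`, `landenSin_crest`, `Tminus_eq`). For fixed `s`, the integrand
and the upper limit both decrease in `r`. The integral diverges logarithmically as `r → 0`
(`exists_forall_lt_perA`). At `r = s - Z²/2`, that is `η = θ`, the upper limit is `0` and the value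
is `T₀` (`T0_eq`). So the period equation has at most one solution, and it has one when `T₀ < 2L`.
For `Z = 0` the upper limit is always `π/2`, the limiting value is `√2 π/√ω`, and the threshold is
`π²/(2L²)`. For `Z > 0`, `T₀` is strictly decreasing in `ω` and crosses `2L` exactly once, which
gives `μ`.

The decrease in `r` is quantitative (`perG_add_le`), so the derivative in `r` does not vanish and
the analytic implicit function theorem applies to the period equation (`analyticAt_branch`). The
period integral is analytic because the inverse square root is analytic on positive continuous
functions and integration is linear. The bound `η ≤ π/(√2 L)`, uniform in `ω` and `Z` (`branch_le`),
takes care of the unbounded rectangles.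

For the peaks, `T₋ = 2L` says that the argument of `dn` reaches `K` at `ξ = L`, about which `dn` is
symmetric; the quartic equation for the crest is the squared jump condition
(`waveDeriv_shift_zero`).

For analyticity in `H¹`, the half-period is read from its minimum, where it solves `ψ = η + ∬ (ωψ -
ψ³)`. For fixed `ω` this involves `Z` only through `η`. Invertibility of `1 - T` for Volterra
operators `T` (`isUnit_one_sub_volterra`) gives both analytic dependence on `η` and uniqueness of
`ψ`. Even reflection is a bounded linear map into `H¹_per`. -/

namespace DnoidalPeak

/-! ### Jacobi's amplitude and the function `dn` for a fixed modulus. -/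

section Elliptic

variable {k : ℝ}

theorem one_sub_sq_mul_sin_sq_pos (hk : k ^ 2 < 1) (t : ℝ) : 0 < 1 - k ^ 2 * Real.sin t ^ 2 := by
  nlinarith [Real.sin_sq_le_one t, sq_nonneg k, sq_nonneg (Real.sin t)]

theorem continuous_ellF_integrand (hk : k ^ 2 < 1) :
    Continuous fun t => 1 / √(1 - k ^ 2 * Real.sin t ^ 2) := by
  refine continuous_const.div (by fun_prop) fun t => ?_
  exact (Real.sqrt_pos.2 (one_sub_sq_mul_sin_sq_pos hk t)).ne'

theorem hasDerivAt_ellF (hk : k ^ 2 < 1) (t : ℝ) :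
    HasDerivAt (fun φ => ellF φ k) (1 / √(1 - k ^ 2 * Real.sin t ^ 2)) t :=
  intervalIntegral.integral_hasDerivAt_right
    ((continuous_ellF_integrand hk).intervalIntegrable _ _)
    ((continuous_ellF_integrand hk).stronglyMeasurableAtFilter _ _)
    (continuous_ellF_integrand hk).continuousAt

theorem ellF_zero : ellF 0 k = 0 := by simp [ellF]

theorem continuous_ellF (hk : k ^ 2 < 1) : Continuous fun φ => ellF φ k :=
  continuous_iff_continuousAt.2 fun t => (hasDerivAt_ellF hk t).continuousAt

theorem strictMono_ellF (hk : k ^ 2 < 1) : StrictMono fun φ => ellF φ k := by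
  refine strictMono_of_hasDerivAt_pos (fun t => hasDerivAt_ellF hk t) fun t => ?_
  have := Real.sqrt_pos.2 (one_sub_sq_mul_sin_sq_pos hk t)
  positivity

/-- The integrand is at least `1`. This linear growth makes `F(·, k)` surjective, so that `am` is a
two-sided inverse. -/
theorem monotone_ellF_sub_id (hk : k ^ 2 < 1) : Monotone fun φ => ellF φ k - φ := by
  refine monotone_of_hasDerivAt_nonneg
    (fun t => (hasDerivAt_ellF hk t).sub (hasDerivAt_id t)) fun t => ?_
  have h := Real.sqrt_pos.2 (one_sub_sq_mul_sin_sq_pos hk t)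
  have h1 : √(1 - k ^ 2 * Real.sin t ^ 2) ≤ 1 := by
    refine Real.sqrt_le_one.2 ?_
    nlinarith [mul_nonneg (sq_nonneg k) (sq_nonneg (Real.sin t))]
  have : 1 ≤ 1 / √(1 - k ^ 2 * Real.sin t ^ 2) := by rwa [le_div_iff₀ h, one_mul]
  simpa using this

theorem surjective_ellF (hk : k ^ 2 < 1) : Function.Surjective fun φ => ellF φ k := by
  refine (continuous_ellF hk).surjective ?_ ?_
  · refine tendsto_atTop_mono' _ ?_ tendsto_id
    filter_upwards [eventually_ge_atTop 0] with t ht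
    have := monotone_ellF_sub_id hk ht
    simp only [ellF_zero] at this
    simp only [id]
    linarith
  · refine tendsto_atBot_mono' _ ?_ tendsto_id
    filter_upwards [eventually_le_atBot 0] with t ht
    have := monotone_ellF_sub_id hk ht
    simp only [ellF_zero] at this
    simp only [id]
    linarith

theorem am_ellF (hk : k ^ 2 < 1) (t : ℝ) : am (ellF t k) k = t :=
  Function.leftInverse_invFun (strictMono_ellF hk).injective t

theorem ellF_am (hk : k ^ 2 < 1) (u : ℝ) : ellF (am u k) k = u :=
  Function.rightInverse_invFun (surjective_ellF hk) u

theorem strictMono_am (hk : k ^ 2 < 1) : StrictMono fun u => am u k := by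
  intro u v huv
  rw [← (strictMono_ellF hk).lt_iff_lt]
  simpa only [ellF_am hk] using huv

theorem continuous_am (hk : k ^ 2 < 1) : Continuous fun u => am u k :=
  (strictMono_am hk).monotone.continuous_of_surjective fun t => ⟨ellF t k, am_ellF hk t⟩

theorem hasDerivAt_am (hk : k ^ 2 < 1) (u : ℝ) : HasDerivAt (fun u => am u k) (dn u k) u := by
  have h := Real.sqrt_pos.2 (one_sub_sq_mul_sin_sq_pos hk (am u k))
  have := HasDerivAt.of_local_left_inverse (continuous_am hk).continuousAt
    (hasDerivAt_ellF hk (am u k)) (by positivity) (Eventually.of_forall (ellF_am hk))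
  simpa [dn, sn] using this

theorem am_zero (hk : k ^ 2 < 1) : am 0 k = 0 := by
  simpa [ellF_zero] using am_ellF hk 0

theorem am_ellK (hk : k ^ 2 < 1) : am (ellK k) k = Real.pi / 2 := am_ellF hk _

theorem ellK_pos (hk : k ^ 2 < 1) : 0 < ellK k := by
  have := strictMono_ellF hk (show (0 : ℝ) < Real.pi / 2 by positivity)
  simpa [ellF_zero, ellK] using this

/-- The integrand is invariant under `t ↦ π - t`. The consequence of interest is the symmetry of
`dn` about `K`. -/
theorem ellF_pi_sub (hk : k ^ 2 < 1) (t : ℝ) : ellF (Real.pi - t) k = 2 * ellK k - ellF t k := by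
  have hi := fun a b => (continuous_ellF_integrand hk).intervalIntegrable (μ := volume) a b
  have h1 : ∫ x in Real.pi / 2..Real.pi - t, 1 / √(1 - k ^ 2 * Real.sin x ^ 2) =
      ∫ x in t..Real.pi / 2, 1 / √(1 - k ^ 2 * Real.sin x ^ 2) := by
    have := intervalIntegral.integral_comp_sub_left
      (fun x => 1 / √(1 - k ^ 2 * Real.sin x ^ 2)) (a := t) (b := Real.pi / 2) Real.pi
    simp only [Real.sin_pi_sub] at this
    rw [this]
    congr 1
    ring
  have h2 := intervalIntegral.integral_add_adjacent_intervals (hi 0 (Real.pi / 2))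
    (hi (Real.pi / 2) (Real.pi - t))
  have h3 := intervalIntegral.integral_add_adjacent_intervals (hi 0 t) (hi t (Real.pi / 2))
  simp only [ellK, ellF]
  linarith

theorem am_two_mul_ellK_sub (hk : k ^ 2 < 1) (u : ℝ) :
    am (2 * ellK k - u) k = Real.pi - am u k := by
  rw [← am_ellF hk (Real.pi - am u k), ellF_pi_sub hk, ellF_am hk]

theorem dn_two_mul_ellK_sub (hk : k ^ 2 < 1) (u : ℝ) : dn (2 * ellK k - u) k = dn u k := by
  simp only [dn, sn, am_two_mul_ellK_sub hk, Real.sin_pi_sub]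

theorem dn_pos (hk : k ^ 2 < 1) (u : ℝ) : 0 < dn u k :=
  Real.sqrt_pos.2 (one_sub_sq_mul_sin_sq_pos hk _)

theorem dn_sq (hk : k ^ 2 < 1) (u : ℝ) : dn u k ^ 2 = 1 - k ^ 2 * Real.sin (am u k) ^ 2 :=
  Real.sq_sqrt (one_sub_sq_mul_sin_sq_pos hk _).le

theorem dn_zero (hk : k ^ 2 < 1) : dn 0 k = 1 := by simp [dn, sn, am_zero hk]

theorem dn_ellK (hk : k ^ 2 < 1) : dn (ellK k) k = √(1 - k ^ 2) := by
  simp [dn, sn, am_ellK hk]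

/-- The derivative of `dn`. -/
noncomputable def dnDeriv (u k : ℝ) : ℝ := -k ^ 2 * Real.sin (am u k) * Real.cos (am u k)

theorem hasDerivAt_dn (hk : k ^ 2 < 1) (u : ℝ) :
    HasDerivAt (fun u => dn u k) (dnDeriv u k) u := by
  have h1 := ((((hasDerivAt_am hk u).sin).pow 2).const_mul (k ^ 2)).const_sub 1
  have h2 := h1.sqrt (one_sub_sq_mul_sin_sq_pos hk _).ne'
  refine h2.congr_deriv ?_
  have := (dn_pos hk u).ne'
  change _ / (2 * dn u k) = _
  simp only [dnDeriv]
  field_simp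
  simp
  ring

theorem hasDerivAt_dnDeriv (hk : k ^ 2 < 1) (u : ℝ) :
    HasDerivAt (fun u => dnDeriv u k) ((2 - k ^ 2) * dn u k - 2 * dn u k ^ 3) u := by
  have h1 := (((hasDerivAt_am hk u).sin).const_mul (-k ^ 2)).mul (hasDerivAt_am hk u).cos
  refine h1.congr_deriv ?_
  have h2 := dn_sq hk u
  have h3 := Real.sin_sq_add_cos_sq (am u k)
  linear_combination (2 * dn u k) * h2 - k ^ 2 * dn u k * h3

theorem continuous_dn (hk : k ^ 2 < 1) : Continuous fun u => dn u k :=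
  continuous_iff_continuousAt.2 fun u => (hasDerivAt_dn hk u).continuousAt

theorem contDiff_dn (hk : k ^ 2 < 1) : ContDiff ℝ 2 fun u => dn u k := by
  have hd : deriv (fun u => dn u k) = fun u => dnDeriv u k :=
    funext fun u => (hasDerivAt_dn hk u).deriv
  have hd' : deriv (fun u => dnDeriv u k) = fun u => (2 - k ^ 2) * dn u k - 2 * dn u k ^ 3 :=
    funext fun u => (hasDerivAt_dnDeriv hk u).deriv
  rw [show (2 : WithTop ℕ∞) = 1 + 1 from rfl, contDiff_succ_iff_deriv, hd]
  refine ⟨fun u => (hasDerivAt_dn hk u).differentiableAt, by simp, ?_⟩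
  rw [contDiff_one_iff_deriv, hd']
  refine ⟨fun u => (hasDerivAt_dnDeriv hk u).differentiableAt, ?_⟩
  have := continuous_dn hk
  fun_prop

theorem arcdn_spec (hk : k ^ 2 < 1) {y : ℝ} (hy : √(1 - k ^ 2) ≤ y) (hy1 : y ≤ 1) :
    arcdn y k ∈ Icc 0 (ellK k) ∧ dn (arcdn y k) k = y := by
  have h : ∃ u ∈ Icc 0 (ellK k), dn u k = y := by
    have := intermediate_value_Icc' (ellK_pos hk).le (continuous_dn hk).continuousOn
    rw [dn_ellK hk, dn_zero hk] at this
    exact this ⟨hy, hy1⟩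
  exact ⟨Function.invFunOn_mem h, Function.invFunOn_eq h⟩

/-- This fixes the signs of the sine and cosine of the amplitude, hence the sign of the slope of the
peak at its crest. -/
theorem am_mem_Icc (hk : k ^ 2 < 1) {u : ℝ} (hu : u ∈ Icc 0 (ellK k)) :
    am u k ∈ Icc 0 (Real.pi / 2) := by
  have h0 := (strictMono_am hk).monotone hu.1
  have h1 := (strictMono_am hk).monotone hu.2
  simp only [am_zero hk, am_ellK hk] at h0 h1
  exact ⟨h0, h1⟩

end Elliptic

/-! ### Landen's transformation of the period integral. -/

noncomputable section Landen

/-- The integrand of the Landen-transformed period integral. -/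
def ker (r s σ : ℝ) : ℝ := 1 / √(2 * r + (s - r) * Real.sin σ ^ 2)

variable {r s p q k : ℝ}

theorem ker_radicand_pos (hr : 0 < r) (hs : 0 < s) (σ : ℝ) :
    0 < 2 * r + (s - r) * Real.sin σ ^ 2 := by
  have h1 := mul_nonneg hs.le (sq_nonneg (Real.sin σ))
  have h2 := mul_nonneg hr.le (sub_nonneg.2 (Real.sin_sq_le_one σ))
  linarith

theorem ker_pos (hr : 0 < r) (hs : 0 < s) (σ : ℝ) : 0 < ker r s σ := by
  have := Real.sqrt_pos.2 (ker_radicand_pos hr hs σ)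
  unfold ker
  positivity

theorem continuous_ker (hr : 0 < r) (hs : 0 < s) : Continuous (ker r s) :=
  continuous_const.div (by fun_prop) fun σ => (Real.sqrt_pos.2 (ker_radicand_pos hr hs σ)).ne'

theorem hasDerivAt_integral_ker (hr : 0 < r) (hs : 0 < s) (t : ℝ) :
    HasDerivAt (fun t => ∫ σ in (0 : ℝ)..t, ker r s σ) (ker r s t) t :=
  intervalIntegral.integral_hasDerivAt_right
    ((continuous_ker hr hs).intervalIntegrable _ _)
    ((continuous_ker hr hs).stronglyMeasurableAtFilter _ _)
    (continuous_ker hr hs).continuousAt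

theorem continuous_integral_ker (hr : 0 < r) (hs : 0 < s) :
    Continuous fun t => ∫ σ in (0 : ℝ)..t, ker r s σ :=
  continuous_iff_continuousAt.2 fun t => (hasDerivAt_integral_ker hr hs t).continuousAt

/-- The sine of the Landen-transformed amplitude. -/
def landenSin (p q D : ℝ) : ℝ := (D - p * q / D) / (p - q)

/-- **Landen's transformation** of the elliptic integral of the first kind. -/
theorem ellF_div_eq_integral_ker (hq : 0 < q) (hqp : q < p) (hk : k ^ 2 = (p ^ 2 - q ^ 2) / p ^ 2)
    {t : ℝ} (ht : t ∈ Icc 0 (Real.pi / 2)) :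
    ellF t k / p =
      ∫ σ in Real.arcsin (landenSin p q (p * √(1 - k ^ 2 * Real.sin t ^ 2)))..(Real.pi / 2),
        ker (2 * p * q) (p ^ 2 + q ^ 2) σ := by
  have hp : 0 < p := hq.trans hqp
  have hpq : 0 < p - q := sub_pos.2 hqp
  have hk1 : k ^ 2 < 1 := by
    rw [hk, div_lt_one (by positivity)]
    nlinarith
  have hkp : p ^ 2 * k ^ 2 = p ^ 2 - q ^ 2 := by rw [hk]; field_simp
  have hr : 0 < 2 * p * q := by positivity
  have hs : 0 < p ^ 2 + q ^ 2 := by positivity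
  set D : ℝ → ℝ := fun t => p * √(1 - k ^ 2 * Real.sin t ^ 2) with hD
  have hDpos : ∀ t, 0 < D t := fun t =>
    mul_pos hp (Real.sqrt_pos.2 (one_sub_sq_mul_sin_sq_pos hk1 t))
  have hDsq : ∀ t, D t ^ 2 = p ^ 2 - (p ^ 2 - q ^ 2) * Real.sin t ^ 2 := fun t => by
    rw [hD, mul_pow, Real.sq_sqrt (one_sub_sq_mul_sin_sq_pos hk1 t).le, ← hkp]
    ring
  have hDcont : Continuous D := by fun_prop
  -- The sum of the two integrals is constant in `t`. At `t = 0` one has `D = p`, so the sine is `1`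
  -- and the sum is the integral from `0` to `π/2`.
  set h : ℝ → ℝ := fun t => ellF t k / p + ∫ σ in (0 : ℝ)..Real.arcsin (landenSin p q (D t)),
    ker (2 * p * q) (p ^ 2 + q ^ 2) σ with hh
  have hcont : Continuous h := by
    refine ((continuous_ellF hk1).div_const p).add ?_
    refine (continuous_integral_ker hr hs).comp (Real.continuous_arcsin.comp ?_)
    exact (hDcont.sub (continuous_const.div hDcont fun t => (hDpos t).ne')).div_const _
  -- Only interior points are used: at `t = 0` and `t = π/2` the sine is `±1`, where `arcsin` is not
  -- differentiable. Continuity of `h` covers the endpoints.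
  have hderiv : ∀ t ∈ Ioo 0 (Real.pi / 2), HasDerivAt h 0 t := by
    intro t ht
    have hst : 0 < Real.sin t := Real.sin_pos_of_pos_of_lt_pi ht.1 (by linarith [ht.2, Real.pi_pos])
    have hc : 0 < Real.cos t := Real.cos_pos_of_mem_Ioo ⟨by linarith [ht.1, Real.pi_pos], ht.2⟩
    have hsc := Real.sin_sq_add_cos_sq t
    have hd := hDpos t
    have hd2 := hDsq t
    have hrt := Real.sqrt_pos.2 (one_sub_sq_mul_sin_sq_pos hk1 t)
    have hDd : HasDerivAt D (-((p ^ 2 - q ^ 2) * Real.sin t * Real.cos t / D t)) t := by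
      have := ((((Real.hasDerivAt_sin t).pow 2).const_mul (k ^ 2)).const_sub 1).sqrt
        (one_sub_sq_mul_sin_sq_pos hk1 t).ne'
      refine (this.const_mul p).congr_deriv ?_
      rw [← hkp, hD]
      simp only [Pi.pow_apply]
      field_simp
      norm_num
    have hy : HasDerivAt (fun t => landenSin p q (D t))
        (-((1 + p * q / D t ^ 2) * (p + q) * Real.sin t * Real.cos t / D t)) t := by
      have := (hDd.sub (hDd.inv hd.ne' |>.const_mul (p * q))).div_const (p - q)
      refine (this.congr_deriv ?_).congr_of_eventuallyEq (Eventually.of_forall fun x => ?_)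
      · field_simp
        ring
      · simp [landenSin, div_eq_mul_inv]
    have h1y : 1 - landenSin p q (D t) ^ 2 =
        ((p + q) * Real.sin t * Real.cos t / D t) ^ 2 := by
      have hc2 : Real.cos t ^ 2 = 1 - Real.sin t ^ 2 := by linarith
      have e1 : D t ^ 2 * (p - q) ^ 2 * (1 - landenSin p q (D t) ^ 2) =
          (p - q) ^ 2 * D t ^ 2 - (D t ^ 2 - p * q) ^ 2 := by
        unfold landenSin
        field_simp
      have e2 : D t ^ 2 * (p - q) ^ 2 * (((p + q) * Real.sin t * Real.cos t / D t) ^ 2) =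
          (p - q) ^ 2 * (p + q) ^ 2 * Real.sin t ^ 2 * Real.cos t ^ 2 := by
        field_simp
      have hne : D t ^ 2 * (p - q) ^ 2 ≠ 0 := by positivity
      refine mul_left_cancel₀ hne ?_
      rw [e1, e2, hd2, hc2]
      ring
    have hpos : 0 < (p + q) * Real.sin t * Real.cos t / D t := by positivity
    have hlt : 0 < 1 - landenSin p q (D t) ^ 2 := by rw [h1y]; positivity
    have hy1 : landenSin p q (D t) ≠ -1 := by
      intro e
      rw [e] at hlt
      norm_num at hlt
    have hy2 : landenSin p q (D t) ≠ 1 := by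
      intro e
      rw [e] at hlt
      norm_num at hlt
    have hlt1 : landenSin p q (D t) ^ 2 < 1 := by linarith
    have habs := abs_lt.1 ((sq_lt_one_iff_abs_lt_one _).1 hlt1)
    -- With `r = 2pq` and `s = p² + q²` the radicand is `4pq + (D - pq/D)² = (D + pq/D)²`, a perfect
    -- square.
    have hker : ker (2 * p * q) (p ^ 2 + q ^ 2) (Real.arcsin (landenSin p q (D t))) =
        1 / (D t + p * q / D t) := by
      rw [ker, Real.sin_arcsin habs.1.le habs.2.le]
      congr 1
      rw [Real.sqrt_eq_iff_mul_self_eq_of_pos (by positivity)]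
      unfold landenSin
      field_simp
      ring
    have h1 := (hasDerivAt_integral_ker hr hs (Real.arcsin (landenSin p q (D t)))).comp t
      ((Real.hasDerivAt_arcsin hy1 hy2).comp t hy)
    refine (((hasDerivAt_ellF hk1 t).div_const p).add h1).congr_deriv ?_
    rw [hker, h1y, Real.sqrt_sq hpos.le]
    have e : 1 / √(1 - k ^ 2 * Real.sin t ^ 2) / p = 1 / D t := by
      rw [hD]
      field_simp
    rw [e]
    field_simp
    ring
  have h0 : h 0 = ∫ σ in (0 : ℝ)..(Real.pi / 2), ker (2 * p * q) (p ^ 2 + q ^ 2) σ := by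
    have : landenSin p q (D 0) = 1 := by
      rw [landenSin, hD]
      simp only [Real.sin_zero]
      norm_num
      field_simp
    simp [hh, this, ellF_zero]
  have hconst : h t = h 0 := by
    rcases ht.1.eq_or_lt with rfl | h0t
    · rfl
    obtain ⟨c, -, hc⟩ := exists_hasDerivAt_eq_slope h (fun _ => 0) h0t hcont.continuousOn
      fun x hx => hderiv x ⟨hx.1, hx.2.trans_le ht.2⟩
    have : t - 0 ≠ 0 := by linarith
    rw [eq_comm, div_eq_zero_iff] at hc
    rcases hc with hc | hc
    · linarith
    · exact absurd hc this
  have hi := fun a b => (continuous_ker hr hs).intervalIntegrable (μ := volume) a b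
  have hadd := intervalIntegral.integral_add_adjacent_intervals
    (hi 0 (Real.arcsin (landenSin p q (D t)))) (hi _ (Real.pi / 2))
  rw [h0] at hconst
  simp only [hh] at hconst
  linarith

theorem integral_ker_neg (r s t : ℝ) :
    ∫ σ in -t..0, ker r s σ = ∫ σ in (0 : ℝ)..t, ker r s σ := by
  have := intervalIntegral.integral_comp_neg (ker r s) (a := 0) (b := t)
  rw [neg_zero] at this
  rw [← this]
  simp [ker]

/-- Half of the period integral, the part over a full quarter of the oscillation. -/
def perA (r s : ℝ) : ℝ := ∫ σ in (0 : ℝ)..(Real.pi / 2), ker r s σ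

/-- Half of the period integral, the part from the middle of the oscillation to the crest. -/
def perB (r s y : ℝ) : ℝ := ∫ σ in (0 : ℝ)..Real.arcsin y, ker r s σ

/-- Landen's formula is used at `t = π/2`, where the lower limit is `arcsin (-1)`, and at the
amplitude of the shift, where `p dn = c`. The difference is an integral from `-π/2`; it is split at
`0`, and evenness of the integrand turns the negative half into `perA`. -/
theorem ellK_sub_arcdn (hq : 0 < q) (hqp : q < p) (hk : k ^ 2 = (p ^ 2 - q ^ 2) / p ^ 2)
    {c : ℝ} (hqc : q ≤ c) (hcp : c ≤ p) :
    (ellK k - arcdn (c / p) k) / p =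
      perA (2 * p * q) (p ^ 2 + q ^ 2) + perB (2 * p * q) (p ^ 2 + q ^ 2) (landenSin p q c) := by
  have hp : 0 < p := hq.trans hqp
  have hpq : 0 < p - q := sub_pos.2 hqp
  have hk1 : k ^ 2 < 1 := by
    rw [hk, div_lt_one (by positivity)]
    nlinarith
  have hr : 0 < 2 * p * q := by positivity
  have hs : 0 < p ^ 2 + q ^ 2 := by positivity
  have hsq : √(1 - k ^ 2) = q / p := by
    rw [Real.sqrt_eq_iff_mul_self_eq_of_pos (by positivity), hk]
    field_simp
    ring
  obtain ⟨hmem, hdn⟩ := arcdn_spec hk1 (y := c / p)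
    (by rw [hsq]; gcongr) ((div_le_one hp).2 hcp)
  have ha := am_mem_Icc hk1 hmem
  have h1 := ellF_div_eq_integral_ker hq hqp hk ha
  have h2 := ellF_div_eq_integral_ker hq hqp hk
    (t := Real.pi / 2) ⟨by positivity, le_rfl⟩
  have e1 : p * √(1 - k ^ 2 * Real.sin (am (arcdn (c / p) k) k) ^ 2) = c := by
    have : √(1 - k ^ 2 * Real.sin (am (arcdn (c / p) k) k) ^ 2) = c / p := hdn
    rw [this]
    field_simp
  have e2 : landenSin p q (p * √(1 - k ^ 2 * Real.sin (Real.pi / 2) ^ 2)) = -1 := by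
    rw [Real.sin_pi_div_two, one_pow, mul_one, hsq, landenSin]
    field_simp
    ring
  rw [ellF_am hk1, e1] at h1
  rw [e2, Real.arcsin_neg_one] at h2
  have hi := fun a b => (continuous_ker hr hs).intervalIntegrable (μ := volume) a b
  have h3 := intervalIntegral.integral_add_adjacent_intervals
    (hi (-(Real.pi / 2)) (Real.arcsin (landenSin p q c))) (hi _ (Real.pi / 2))
  have h4 := intervalIntegral.integral_add_adjacent_intervals
    (hi (-(Real.pi / 2)) 0) (hi 0 (Real.arcsin (landenSin p q c)))
  rw [integral_ker_neg] at h4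
  rw [sub_div]
  change ellF (Real.pi / 2) k / p - _ = _
  rw [h1, h2, perA, perB]
  linarith

end Landen

/-! ### The peak parameters in terms of `r = 2 η₁ η₂` and `s = 2ω`. -/

noncomputable section Parameters

variable {η ω Z : ℝ}

/-- The sine of the upper limit of the second half of the period integral. -/
def crestSin (r s Z : ℝ) : ℝ := √((s - r - Z ^ 2 / 2) / (s - r))

/-- The period integral, as a function of `r = 2 η₁ η₂` and `s = η₁² + η₂²`. -/
def perG (r s Z : ℝ) : ℝ := perA r s + perB r s (crestSin r s Z)

/-- The pair `(θ, λ)` is the limiting pair `(η₂, η₁)` at which the discriminant under the root in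
`Φ²` vanishes. -/
theorem theta_lam_facts (hZ : 0 ≤ Z) (hω : Z ^ 2 / 4 < ω) :
    0 < theta ω Z ∧ theta ω Z ≤ lam ω Z ∧ theta ω Z ^ 2 + lam ω Z ^ 2 = 2 * ω ∧
      theta ω Z * lam ω Z = ω - Z ^ 2 / 4 ∧
      lam ω Z ^ 2 - theta ω Z ^ 2 = √2 * |Z| * √(ω - Z ^ 2 / 8) := by
  have hpos : 0 < ω - Z ^ 2 / 8 := by nlinarith [sq_nonneg Z]
  have h2 : √2 * √2 = (2 : ℝ) := Real.mul_self_sqrt (by norm_num)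
  have he := Real.mul_self_sqrt hpos.le
  have hepos := Real.sqrt_pos.2 hpos
  have hs2 : 0 < √(2 : ℝ) := by positivity
  unfold theta lam
  rw [abs_of_nonneg hZ]
  set e := √(ω - Z ^ 2 / 8)
  have hf : 0 ≤ √2 / 4 * Z := by positivity
  have hprod : (-(√2 / 4) * Z + e) * (√2 / 4 * Z + e) = ω - Z ^ 2 / 4 := by
    linear_combination he - Z ^ 2 / 16 * h2
  refine ⟨?_, by linarith, ?_, hprod, by ring⟩
  · refine pos_of_mul_pos_left (b := √2 / 4 * Z + e) ?_ (by positivity)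
    rw [hprod]
    linarith
  · linear_combination 2 * he + Z ^ 2 / 8 * h2

theorem eta1_sq (h : η ^ 2 < ω) : eta1 η ω ^ 2 = 2 * ω - η ^ 2 := by
  refine Real.sq_sqrt ?_
  nlinarith [sq_nonneg η]

theorem lt_eta1 (h : η ^ 2 < ω) : η < eta1 η ω := by
  refine Real.lt_sqrt_of_sq_lt ?_
  linarith

/-- The squares of `2ω - Z²/2 = 2θλ` and `2η₁η` differ by `4(θ² - η²)(2ω - θ² - η²)`, whose last
factor is nonnegative since `θ², η² ≤ ω`. The range of `η` thus becomes the range `0 < r < s -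
Z²/2`. -/
theorem mem_Ioo_theta_iff (hZ : 0 ≤ Z) (hω : Z ^ 2 / 4 < ω) :
    η ∈ Ioo 0 (theta ω Z) ↔ 0 < η ∧ η ^ 2 < ω ∧ 2 * eta1 η ω * η < 2 * ω - Z ^ 2 / 2 := by
  obtain ⟨ht, htl, hs, hp, -⟩ := theta_lam_facts hZ hω
  set θ := theta ω Z
  set l := lam ω Z
  have hsq : (2 * ω - Z ^ 2 / 2) ^ 2 = 4 * (θ ^ 2 * l ^ 2) := by
    rw [← mul_pow, hp]
    ring
  have hl : l ^ 2 = 2 * ω - θ ^ 2 := by linarith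
  rw [hl] at hsq
  have hθω : θ ^ 2 ≤ ω := by nlinarith
  constructor
  · rintro ⟨h0, h1⟩
    have h2 : η ^ 2 < θ ^ 2 := by nlinarith
    have h3 : η ^ 2 < ω := h2.trans_le hθω
    refine ⟨h0, h3, ?_⟩
    refine lt_of_pow_lt_pow_left₀ 2 (by linarith) ?_
    rw [hsq, mul_pow, mul_pow, eta1_sq h3]
    nlinarith [mul_pos (sub_pos.2 h2) (show 0 < 2 * ω - η ^ 2 - θ ^ 2 by linarith)]
  · rintro ⟨h0, h1, h2⟩
    refine ⟨h0, ?_⟩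
    by_contra! hc
    have h3 : θ ^ 2 ≤ η ^ 2 := by nlinarith
    have h4 : (2 * eta1 η ω * η) ^ 2 < (2 * ω - Z ^ 2 / 2) ^ 2 := by
      have : 0 ≤ eta1 η ω := Real.sqrt_nonneg _
      exact pow_lt_pow_left₀ h2 (by positivity) (by norm_num)
    rw [hsq, mul_pow, mul_pow, eta1_sq h1] at h4
    nlinarith [mul_nonneg (sub_nonneg.2 h3) (show 0 ≤ 2 * ω - η ^ 2 - θ ^ 2 by linarith)]

/-- The relations between the parameters of a dnoidal peak. -/
theorem param_facts (hZ : 0 ≤ Z) (hω : Z ^ 2 / 4 < ω) (hη : η ∈ Ioo 0 (theta ω Z)) :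
    0 < η ∧ η < eta1 η ω ∧ eta1 η ω ^ 2 + η ^ 2 = 2 * ω ∧
      modulus η ω ^ 2 = (eta1 η ω ^ 2 - η ^ 2) / eta1 η ω ^ 2 ∧ modulus η ω ^ 2 < 1 ∧
      2 * eta1 η ω * η < 2 * ω - Z ^ 2 / 2 := by
  obtain ⟨h0, h1, h2⟩ := (mem_Ioo_theta_iff hZ hω).1 hη
  have hp := lt_eta1 h1
  have hp2 := eta1_sq h1
  have hk : modulus η ω ^ 2 = (eta1 η ω ^ 2 - η ^ 2) / eta1 η ω ^ 2 := by
    rw [modulus, Real.sq_sqrt, hp2]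
    · congr 1
      ring
    · refine div_nonneg ?_ ?_ <;> nlinarith [sq_nonneg η]
  refine ⟨h0, hp, by linarith, hk, ?_, h2⟩
  rw [hk, div_lt_one (by nlinarith)]
  nlinarith

/-- `Φ²` is the larger root of `X² - (2ω - Z²/2) X + η² η₁²`. The product of the roots is `η² η₁²`,
which gives `η₁ η ≤ Φ²`. -/
theorem crest_facts (hZ : 0 ≤ Z) (hω : Z ^ 2 / 4 < ω) (hη : η ∈ Ioo 0 (theta ω Z)) :
    0 < crest η ω Z ∧ η ≤ crest η ω Z ∧ crest η ω Z ≤ eta1 η ω ∧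
      crest η ω Z ^ 4 - (2 * ω - Z ^ 2 / 2) * crest η ω Z ^ 2 + η ^ 2 * eta1 η ω ^ 2 = 0 ∧
      eta1 η ω * η ≤ crest η ω Z ^ 2 := by
  obtain ⟨h0, hp, hs, -, -, hr⟩ := param_facts hZ hω hη
  have hp2 := eta1_sq ((mem_Ioo_theta_iff hZ hω).1 hη).2.1
  unfold crest
  rw [← hp2]
  set p := eta1 η ω
  set b := 2 * ω - Z ^ 2 / 2 with hb
  have hp0 : 0 < p := h0.trans hp
  have hb0 : 0 < b := by linarith
  have hdisc : 0 ≤ b ^ 2 - 4 * η ^ 2 * p ^ 2 := by nlinarith [mul_pos hp0 h0]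
  have hd := Real.mul_self_sqrt hdisc
  have hd0 := Real.sqrt_nonneg (b ^ 2 - 4 * η ^ 2 * p ^ 2)
  set d := √(b ^ 2 - 4 * η ^ 2 * p ^ 2)
  have hX : 0 < (b + d) / 2 := by linarith
  have hc := Real.sq_sqrt hX.le
  have hc0 := Real.sqrt_pos.2 hX
  set c := √((b + d) / 2)
  have hlow : p * η ≤ c ^ 2 := by rw [hc]; linarith
  refine ⟨hc0, ?_, ?_, ?_, hlow⟩
  · refine le_of_sq_le_sq ?_ hc0.le
    nlinarith
  · refine le_of_sq_le_sq ?_ hp0.le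
    rw [hc]
    -- This is `Φ ≤ η₁`; it follows from `(2p² - b)² - d² = 2p²Z² ≥ 0`.
    have : d ≤ 2 * p ^ 2 - b := by
      refine abs_le_of_sq_le_sq' ?_ ?_ |>.2
      · have e : (2 * p ^ 2 - b) ^ 2 - d ^ 2 = 2 * p ^ 2 * Z ^ 2 := by
          rw [hb] at hd ⊢
          linear_combination 4 * p ^ 2 * hs - hd
        have : 0 ≤ 2 * p ^ 2 * Z ^ 2 := by positivity
        linarith
      · nlinarith [sq_nonneg Z]
    linarith
  · have : c ^ 4 = ((b + d) / 2) ^ 2 := by rw [← hc]; ring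
    rw [this, hc]
    linear_combination hd / 4

/-- Dividing the quartic for `Φ` by `Φ²` gives `(Φ - η₁η/Φ)² = s - r - Z²/2`, while `(η₁ - η)² = s -
r`. The bound `η₁ η ≤ Φ²` selects the nonnegative root. -/
theorem landenSin_crest (hZ : 0 ≤ Z) (hω : Z ^ 2 / 4 < ω) (hη : η ∈ Ioo 0 (theta ω Z)) :
    landenSin (eta1 η ω) η (crest η ω Z) = crestSin (2 * eta1 η ω * η) (2 * ω) Z := by
  obtain ⟨h0, hp, hs, -, -, hr⟩ := param_facts hZ hω hη
  obtain ⟨hc, -, -, heq, hlow⟩ := crest_facts hZ hω hη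
  set p := eta1 η ω
  set c := crest η ω Z
  have hpq : 0 < p - η := sub_pos.2 hp
  rw [crestSin, eq_comm, Real.sqrt_eq_iff_mul_self_eq, landenSin]
  · rw [← hs]
    have : p ^ 2 + η ^ 2 - 2 * p * η = (p - η) ^ 2 := by ring
    rw [this]
    rw [← hs] at heq
    field_simp
    linear_combination (-2) * heq
  · refine div_nonneg (by linarith) (by nlinarith [sq_nonneg Z])
  · refine div_nonneg ?_ hpq.le
    rw [sub_nonneg, div_le_iff₀ hc]
    nlinarith

theorem Tminus_eq (hZ : 0 ≤ Z) (hω : Z ^ 2 / 4 < ω) (hη : η ∈ Ioo 0 (theta ω Z)) :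
    Tminus η ω Z = 2 * √2 * perG (2 * eta1 η ω * η) (2 * ω) Z := by
  obtain ⟨h0, hp, hs, hk, -, hr⟩ := param_facts hZ hω hη
  obtain ⟨-, hc1, hc2, -, -⟩ := crest_facts hZ hω hη
  have := ellK_sub_arcdn h0 hp hk hc1 hc2
  rw [landenSin_crest hZ hω hη, hs] at this
  rw [perG, ← this, Tminus, shift]
  ring

/-- The limiting crest is `√(θλ)`, whose Landen sine is `0`; only the quarter-oscillation part of
the integral remains. -/
theorem T0_eq (hZ : 0 < Z) (hω : Z ^ 2 / 4 < ω) :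
    T0 ω Z = 2 * √2 * perA (2 * ω - Z ^ 2 / 2) (2 * ω) := by
  obtain ⟨ht, htl, hs, hp, hd⟩ := theta_lam_facts hZ.le hω
  have hpos : 0 < ω - Z ^ 2 / 8 := by nlinarith [sq_nonneg Z]
  have hlt : theta ω Z < lam ω Z := by
    unfold theta lam
    have : 0 < √2 / 4 * |Z| := by positivity
    linarith
  have hl : 0 < lam ω Z := ht.trans hlt
  have hk : modulus0 ω Z ^ 2 = (lam ω Z ^ 2 - theta ω Z ^ 2) / lam ω Z ^ 2 := by
    rw [modulus0, Real.sq_sqrt (by positivity), hd]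
  have hc0 : 0 < ω - Z ^ 2 / 4 := by linarith
  have hc := Real.sq_sqrt hc0.le
  have hcp := Real.sqrt_pos.2 hc0
  have := ellK_sub_arcdn ht hlt hk (c := √(ω - Z ^ 2 / 4))
    (le_of_sq_le_sq (by rw [hc, ← hp]; nlinarith) hcp.le)
    (le_of_sq_le_sq (by rw [hc, ← hp]; nlinarith) hl.le)
  have h0 : landenSin (lam ω Z) (theta ω Z) (√(ω - Z ^ 2 / 4)) = 0 := by
    rw [landenSin, mul_comm (lam ω Z), hp]
    simp
  rw [h0, mul_assoc, mul_comm (lam ω Z) (theta ω Z), hp, add_comm (lam ω Z ^ 2), hs] at this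
  have hB : ∀ r s, perB r s 0 = 0 := by simp [perB]
  rw [hB, add_zero, mul_sub] at this
  rw [T0, shift0, show 2 * ω - Z ^ 2 / 2 = 2 * ω - 2 * (Z ^ 2 / 4) by ring, ← this]
  ring

end Parameters

/-! ### Analytic and Volterra operators on spaces of continuous functions. -/

noncomputable section ContinuousFunctions

open scoped ContDiff

/-- It identifies the partial derivative in the second variable, whose invertibility is the
hypothesis of the implicit function theorem. -/
theorem fderiv_comp_inr {E₁ E₂ F : Type*} [NormedAddCommGroup E₁] [NormedSpace ℝ E₁]
    [NormedAddCommGroup E₂] [NormedSpace ℝ E₂] [NormedAddCommGroup F] [NormedSpace ℝ F]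
    {f : E₁ × E₂ → F} {u : E₁ × E₂} {A : E₂ →L[ℝ] F} (hf : DifferentiableAt ℝ f u)
    (hA : HasFDerivAt (fun y => f (u.1, y)) A u.2) :
    fderiv ℝ f u ∘L .inr ℝ E₁ E₂ = A := by
  have h : HasFDerivAt (fun y => f (u.1, y)) (fderiv ℝ f u ∘L .inr ℝ E₁ E₂) u.2 :=
    HasFDerivAt.comp (f := fun y => (u.1, y)) u.2 hf.hasFDerivAt (hasFDerivAt_prodMk_right u.1 u.2)
  exact h.unique hA

/-- The inverse square root is analytic on the positive continuous functions. -/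
theorem exists_analyticAt_inv_sqrt {X : Type*} [TopologicalSpace X] [CompactSpace X]
    (f₀ : C(X, ℝ)) (hf₀ : ∀ x, 0 < f₀ x) :
    ∃ R : C(X, ℝ) → C(X, ℝ), AnalyticAt ℝ R f₀ ∧
      ∀ᶠ f in 𝓝 f₀, ∀ x, R f x = 1 / √(f x) := by
  have hsq : ∀ x, √(f₀ x) ≠ 0 := fun x => (Real.sqrt_pos.2 (hf₀ x)).ne'
  set g₀ : C(X, ℝ) := ⟨fun x => 1 / √(f₀ x), by fun_prop (disch := exact hsq _)⟩ with hg₀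
  -- The reciprocal of `2 g₀ f₀`; multiplication by `2 g₀ f₀` is the derivative in `g` of `g² f₀` at
  -- `g₀ = 1/√f₀`.
  set v₀ : C(X, ℝ) := ⟨fun x => √(f₀ x) / (2 * f₀ x), by
    refine (Real.continuous_sqrt.comp f₀.continuous).div (by fun_prop) fun x => ?_
    have := (hf₀ x).ne'
    positivity⟩ with hv₀
  set F : C(X, ℝ) × C(X, ℝ) → C(X, ℝ) := fun u => u.2 * u.2 * u.1 with hF
  have hcd : ContDiff ℝ ω F := by fun_prop
  set A : C(X, ℝ) →L[ℝ] C(X, ℝ) := ContinuousLinearMap.mul ℝ _ ((g₀ + g₀) * f₀) with hA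
  have hder : HasFDerivAt (fun g => F ((f₀, g₀).1, g)) A (f₀, g₀).2 := by
    have h := ((hasFDerivAt_id (𝕜 := ℝ) g₀).mul (hasFDerivAt_id g₀)).mul_const f₀
    refine h.congr_fderiv ?_
    ext y x
    simp [hA]
    ring
  have hgv : ((g₀ + g₀) * f₀) * v₀ = 1 := by
    ext x
    have h1 := hsq x
    have h2 := (hf₀ x).ne'
    simp [hg₀, hv₀]
    field_simp
    norm_num
  have hinv : (fderiv ℝ F (f₀, g₀) ∘L .inr ℝ C(X, ℝ) C(X, ℝ)).IsInvertible := by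
    rw [fderiv_comp_inr (hcd.differentiable (by simp)).differentiableAt hder]
    refine ContinuousLinearMap.IsInvertible.of_inverse
      (g := ContinuousLinearMap.mul ℝ _ v₀) ?_ ?_
    · ext1 y
      change ((g₀ + g₀) * f₀) * (v₀ * y) = y
      rw [← mul_assoc, hgv, one_mul]
    · ext1 y
      change v₀ * (((g₀ + g₀) * f₀) * y) = y
      rw [← mul_assoc, mul_comm v₀, hgv, one_mul]
  have hc : ContDiffAt ℝ ω F (f₀, g₀) := hcd.contDiffAt
  refine ⟨hc.implicitFunction (by simp) hinv,
    (hc.contDiffAt_implicitFunction (by simp) hinv).analyticAt, ?_⟩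
  have h1 := hc.eventually_apply_implicitFunction (by simp) hinv
  have h2 := (hc.contDiffAt_implicitFunction (by simp) hinv).continuousAt
  have h3 := hc.implicitFunction_apply_self (by simp) hinv
  -- Positivity is an open condition on a compact space. It forces the solution of `g² f = 1` to be
  -- the positive root `1/√f`.
  have hopen : IsOpen {g : C(X, ℝ) | MapsTo g univ (Ioi 0)} :=
    ContinuousMap.isOpen_setOfPred_mapsTo isCompact_univ isOpen_Ioi
  have h4 := h2.eventually (hopen.mem_nhds (by
    rw [h3]
    intro x _
    have := (hf₀ x)
    simp [hg₀, this]))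
  have h5 : ∀ᶠ f in 𝓝 f₀, f ∈ {g : C(X, ℝ) | MapsTo g univ (Ioi 0)} :=
    hopen.mem_nhds fun x _ => hf₀ x
  filter_upwards [h1, h4, h5] with f hf hg hpos x
  have e : (F (f₀, g₀)) x = 1 := by
    have h1 := Real.mul_self_sqrt (hf₀ x).le
    have h2 := hsq x
    simp only [hF, hg₀, ContinuousMap.mul_apply, ContinuousMap.coe_mk]
    field_simp
    nlinarith
  have e2 := congrArg (fun g : C(X, ℝ) => g x) hf
  simp only [e] at e2
  simp only [hF, ContinuousMap.mul_apply] at e2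
  have hp : 0 < f x := hpos (mem_univ x)
  have hg' : 0 < hc.implicitFunction (by simp) hinv f x := hg (mem_univ x)
  rw [eq_div_iff (Real.sqrt_pos.2 hp).ne']
  have h0 := Real.sq_sqrt hp.le
  refine (pow_eq_one_iff_of_nonneg (mul_nonneg hg'.le (Real.sqrt_nonneg _)) two_ne_zero).1 ?_
  rw [mul_pow, h0, sq]
  exact e2

variable {L : ℝ}

theorem intervalIntegrable_IccExtend (hL : 0 ≤ L) (f : C(Icc (0 : ℝ) L, ℝ)) (a b : ℝ) :
    IntervalIntegrable (IccExtend hL f) volume a b :=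
  (f.continuous.Icc_extend' (h := hL)).intervalIntegrable _ _

theorem hasDerivAt_integral_IccExtend (hL : 0 ≤ L) (f : C(Icc (0 : ℝ) L, ℝ)) (x : ℝ) :
    HasDerivAt (fun x => ∫ t in (0 : ℝ)..x, IccExtend hL f t) (IccExtend hL f x) x :=
  intervalIntegral.integral_hasDerivAt_right (intervalIntegrable_IccExtend hL f _ _)
    ((f.continuous.Icc_extend' (h := hL)).stronglyMeasurableAtFilter _ _)
    (f.continuous.Icc_extend' (h := hL)).continuousAt

theorem abs_integral_IccExtend_le (hL : 0 ≤ L) (f : C(Icc (0 : ℝ) L, ℝ)) {x : ℝ}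
    (hx : x ∈ Icc 0 L) : |∫ t in (0 : ℝ)..x, IccExtend hL f t| ≤ L * ‖f‖ := by
  have h := intervalIntegral.norm_integral_le_of_norm_le_const (a := 0) (b := x) (C := ‖f‖)
    (f := IccExtend hL f) fun t _ => f.norm_coe_le_norm _
  rw [Real.norm_eq_abs] at h
  refine h.trans ?_
  rw [sub_zero, abs_of_nonneg hx.1, mul_comm]
  exact mul_le_mul_of_nonneg_right hx.2 (norm_nonneg f)

/-- The primitive vanishing at `0`, as an operator on `C([0, L])`. -/
def prim (hL : 0 ≤ L) : C(Icc (0 : ℝ) L, ℝ) →L[ℝ] C(Icc (0 : ℝ) L, ℝ) :=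
  LinearMap.mkContinuous
    { toFun := fun f => ⟨fun x => ∫ t in (0 : ℝ)..x, IccExtend hL f t,
        (continuous_iff_continuousAt.2 fun x =>
          (hasDerivAt_integral_IccExtend hL f x).continuousAt).comp continuous_subtype_val⟩
      map_add' := fun f g => by
        ext x
        simp only [ContinuousMap.coe_mk, ContinuousMap.add_apply]
        rw [← intervalIntegral.integral_add (intervalIntegrable_IccExtend hL f _ _)
          (intervalIntegrable_IccExtend hL g _ _)]
        rfl
      map_smul' := fun c f => by
        ext x
        simp only [ContinuousMap.coe_mk, ContinuousMap.smul_apply, RingHom.id_apply, smul_eq_mul]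
        rw [← intervalIntegral.integral_const_mul]
        rfl }
    L fun f => (ContinuousMap.norm_le _ (mul_nonneg hL (norm_nonneg f))).2 fun x =>
      abs_integral_IccExtend_le hL f x.2

theorem prim_apply (hL : 0 ≤ L) (f : C(Icc (0 : ℝ) L, ℝ)) (x : Icc (0 : ℝ) L) :
    prim hL f x = ∫ t in (0 : ℝ)..x, IccExtend hL f t := rfl

/-- The primitive of an explicitly given function. -/
theorem prim_apply_eq_integral (hL : 0 ≤ L) (f : C(Icc (0 : ℝ) L, ℝ)) {g : ℝ → ℝ}
    (h : ∀ x, f x = g x) (x : Icc (0 : ℝ) L) : prim hL f x = ∫ t in (0 : ℝ)..x, g t := by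
  rw [prim_apply]
  refine intervalIntegral.integral_congr fun t ht => ?_
  rw [uIcc_of_le x.2.1] at ht
  rw [IccExtend_of_mem hL f ⟨ht.1, ht.2.trans x.2.2⟩, h]

/-- Of the two integrations in each application, one is estimated crudely by a factor `L`; the other
raises the power of `x` and builds the factorial. -/
theorem norm_volterra_pow_le (hL : 0 ≤ L) (q f : C(Icc (0 : ℝ) L, ℝ)) (n : ℕ)
    (x : Icc (0 : ℝ) L) :
    |((prim hL ∘L prim hL ∘L ContinuousLinearMap.mul ℝ _ q) ^ n) f x| ≤
      ‖f‖ * (‖q‖ * L) ^ n * (x : ℝ) ^ n / n.factorial := by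
  induction n generalizing x with
  | zero => simpa using f.norm_coe_le_norm x
  | succ n ih =>
    rw [pow_succ']
    set T := prim hL ∘L prim hL ∘L ContinuousLinearMap.mul ℝ _ q with hT
    set h := (T ^ n) f with hh
    have e : (T * T ^ n) f = prim hL (prim hL (q * h)) := rfl
    rw [e]
    have h1 : ∀ y : Icc (0 : ℝ) L, |prim hL (q * h) y| ≤
        (‖f‖ * (‖q‖ * L) ^ n * ‖q‖ * L / n.factorial) * (y : ℝ) ^ n := by
      intro y
      have := intervalIntegral.norm_integral_le_of_norm_le_const (a := 0) (b := y)
        (f := IccExtend hL (q * h)) (C := ‖q‖ * (‖f‖ * (‖q‖ * L) ^ n * (y : ℝ) ^ n / n.factorial))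
        fun t ht => by
          rw [uIoc_of_le y.2.1] at ht
          have htm : t ∈ Icc 0 L := ⟨ht.1.le, ht.2.trans y.2.2⟩
          rw [IccExtend_of_mem hL _ htm, ContinuousMap.mul_apply, norm_mul]
          refine mul_le_mul (q.norm_coe_le_norm _) ((ih ⟨t, htm⟩).trans ?_)
            (norm_nonneg _) (norm_nonneg _)
          have := ht.1.le
          have := ht.2
          gcongr
      rw [Real.norm_eq_abs, sub_zero, abs_of_nonneg y.2.1] at this
      rw [prim_apply]
      refine this.trans ?_
      have hy : (y : ℝ) ≤ L := y.2.2
      have hy0 : 0 ≤ (y : ℝ) := y.2.1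
      calc _ ≤ ‖q‖ * (‖f‖ * (‖q‖ * L) ^ n * (y : ℝ) ^ n / n.factorial) * L := by gcongr
        _ = _ := by ring
    rw [prim_apply]
    have h2 := intervalIntegral.norm_integral_le_of_norm_le (a := 0) (b := (x : ℝ)) (μ := volume)
      (f := IccExtend hL (prim hL (q * h)))
      (g := fun t => (‖f‖ * (‖q‖ * L) ^ n * ‖q‖ * L / n.factorial) * t ^ n) x.2.1
      (Eventually.of_forall fun t ht => by
        have htm : t ∈ Icc 0 L := ⟨ht.1.le, ht.2.trans x.2.2⟩
        rw [IccExtend_of_mem hL _ htm]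
        exact h1 ⟨t, htm⟩)
      ((continuous_const.mul (continuous_pow n)).intervalIntegrable _ _)
    rw [Real.norm_eq_abs] at h2
    refine h2.trans (le_of_eq ?_)
    rw [intervalIntegral.integral_const_mul, integral_pow, Nat.factorial_succ]
    push_cast
    have : (n.factorial : ℝ) ≠ 0 := by positivity
    field_simp
    ring

/-- Some power `T ^ n` has norm below `1`, so `1 - T ^ n` is invertible. It is the product of `1 -
T` with a commuting geometric sum, and therefore `1 - T` is invertible with no smallness condition
on `q` or `L`. -/
theorem isUnit_one_sub_volterra (hL : 0 ≤ L) (q : C(Icc (0 : ℝ) L, ℝ)) :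
    IsUnit (1 - prim hL ∘L prim hL ∘L ContinuousLinearMap.mul ℝ _ q) := by
  set T := prim hL ∘L prim hL ∘L ContinuousLinearMap.mul ℝ _ q with hT
  have hn : ∀ n : ℕ, ‖T ^ n‖ ≤ (‖q‖ * L * L) ^ n / n.factorial := by
    intro n
    refine ContinuousLinearMap.opNorm_le_bound _ (by positivity) fun f => ?_
    refine (ContinuousMap.norm_le _ (by positivity)).2 fun x => ?_
    refine (norm_volterra_pow_le hL q f n x).trans ?_
    have hx : (x : ℝ) ≤ L := x.2.2
    have hx0 : 0 ≤ (x : ℝ) := x.2.1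
    calc _ ≤ ‖f‖ * (‖q‖ * L) ^ n * L ^ n / n.factorial := by gcongr
      _ = _ := by rw [mul_pow (‖q‖ * L)]; ring
  obtain ⟨n, hlt⟩ := ((FloorSemiring.tendsto_pow_div_factorial_atTop (‖q‖ * L * L)).eventually
    (gt_mem_nhds one_pos)).exists
  have hu := isUnit_one_sub_of_norm_lt_one (x := T ^ n) ((hn n).trans_lt hlt)
  rw [← mul_neg_geom_sum T n] at hu
  have hcomm : Commute (1 - T) (∑ i ∈ Finset.range n, T ^ i) := by
    rw [Commute, SemiconjBy, mul_neg_geom_sum, geom_sum_mul_neg]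
  exact (hcomm.isUnit_mul_iff.1 hu).1

end ContinuousFunctions

/-! ### Analyticity, monotonicity and limiting values of the period integral. -/

noncomputable section PeriodIntegral

open scoped ContDiff

variable {r r' s y Z : ℝ}

/-- The radicand is an affine function of `(r, s)` with values in `C([0, π/2])`. Composing it with
the analytic inverse square root and with integration, a continuous linear functional, gives `perA`.
-/
theorem analyticAt_perA (hr : 0 < r) (hs : 0 < s) :
    AnalyticAt ℝ (fun u : ℝ × ℝ => perA u.1 u.2) (r, s) := by
  have hpi : (0 : ℝ) ≤ Real.pi / 2 := by positivity
  set Q : C(Icc (0 : ℝ) (Real.pi / 2), ℝ) := ⟨fun x => Real.sin x ^ 2, by fun_prop⟩ with hQ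
  set f : ℝ × ℝ → C(Icc (0 : ℝ) (Real.pi / 2), ℝ) :=
    fun u => (2 * u.1) • (1 : C(Icc (0 : ℝ) (Real.pi / 2), ℝ)) + (u.2 - u.1) • Q with hf
  have hfc : ContDiff ℝ ω f := by fun_prop
  have hfx : ∀ u x, f u x = 2 * u.1 + (u.2 - u.1) * Real.sin x ^ 2 := fun u x => by
    simp [hf, hQ]
  obtain ⟨R, hR, hRf⟩ := exists_analyticAt_inv_sqrt (f (r, s)) fun x => by
    rw [hfx]
    exact ker_radicand_pos hr hs _
  set E := (ContinuousMap.evalCLM ℝ (⟨Real.pi / 2, hpi, le_rfl⟩ : Icc (0 : ℝ) (Real.pi / 2))).comp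
    (prim hpi) with hE
  have h1 : AnalyticAt ℝ (fun u => E (R (f u))) (r, s) :=
    (E.analyticAt _).comp (hR.comp hfc.contDiffAt.analyticAt)
  refine h1.congr ?_
  filter_upwards [hfc.continuous.continuousAt.eventually hRf] with u hu
  exact prim_apply_eq_integral hpi (R (f u)) (g := ker u.1 u.2)
    (fun x => by rw [hu, hfx]; rfl) _

/-- The substitution `sin σ = y x` moves the variable endpoint into the integrand, so that the
argument for `perA` works on the fixed interval `[0, 1]`. -/
theorem perB_eq (hr : 0 < r) (hs : 0 < s) (hy : |y| < 1) :
    perB r s y = y * ∫ x in (0 : ℝ)..1,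
      1 / √((1 - y ^ 2 * x ^ 2) * (2 * r + (s - r) * (y ^ 2 * x ^ 2))) := by
  have hyx : ∀ x ∈ uIcc (0 : ℝ) 1, |y * x| < 1 := by
    intro x hx
    rw [uIcc_of_le zero_le_one] at hx
    rw [abs_mul, abs_of_nonneg hx.1]
    nlinarith [abs_nonneg y, hx.1, hx.2]
  have hpos : ∀ x ∈ uIcc (0 : ℝ) 1, 0 < 1 - (y * x) ^ 2 := fun x hx => by
    have := (sq_lt_one_iff_abs_lt_one _).2 (hyx x hx)
    linarith
  have h := intervalIntegral.integral_comp_mul_deriv (a := 0) (b := 1)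
    (f := fun x => Real.arcsin (y * x)) (f' := fun x => 1 / √(1 - (y * x) ^ 2) * y)
    (g := ker r s) (fun x hx => by
      have := abs_lt.1 (hyx x hx)
      have h := (Real.hasDerivAt_arcsin this.1.ne' this.2.ne).comp x
        ((hasDerivAt_id x).const_mul y)
      simpa [Function.comp_def] using h)
    (by
      refine ContinuousOn.mul (ContinuousOn.div (by fun_prop) (by fun_prop) fun x hx => ?_)
        (by fun_prop)
      exact (Real.sqrt_pos.2 (hpos x hx)).ne')
    (continuous_ker hr hs)
  simp only [mul_zero, mul_one, Real.arcsin_zero] at h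
  rw [perB, ← h, ← intervalIntegral.integral_const_mul]
  refine intervalIntegral.integral_congr fun x hx => ?_
  have h1 := abs_lt.1 (hyx x hx)
  have h2 := hpos x hx
  simp only [Function.comp, ker]
  rw [Real.sin_arcsin h1.1.le h1.2.le, ← mul_pow, Real.sqrt_mul h2.le]
  rw [← mul_assoc, one_div_mul_one_div, mul_comm (√(1 - _))]
  ring

theorem analyticAt_perB (hr : 0 < r) (hs : 0 < s) (hy : |y| < 1) :
    AnalyticAt ℝ (fun u : ℝ × ℝ × ℝ => perB u.1 u.2.1 u.2.2) (r, s, y) := by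
  set Q : C(Icc (0 : ℝ) 1, ℝ) := ⟨fun x => (x : ℝ) ^ 2, by fun_prop⟩ with hQ
  set f : ℝ × ℝ × ℝ → C(Icc (0 : ℝ) 1, ℝ) :=
    fun u => (1 - u.2.2 ^ 2 • Q) * ((2 * u.1) • (1 : C(Icc (0 : ℝ) 1, ℝ)) +
      ((u.2.1 - u.1) * u.2.2 ^ 2) • Q) with hf
  have hfc : ContDiff ℝ ω f := by fun_prop
  have hfx : ∀ u x, f u x = (1 - u.2.2 ^ 2 * (x : ℝ) ^ 2) *
      (2 * u.1 + (u.2.1 - u.1) * (u.2.2 ^ 2 * (x : ℝ) ^ 2)) := fun u x => by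
    simp [hf, hQ]
    ring_nf
    simp
  obtain ⟨R, hR, hRf⟩ := exists_analyticAt_inv_sqrt (f (r, s, y)) fun x => by
    rw [hfx]
    have h1 : y ^ 2 * (x : ℝ) ^ 2 < 1 := by
      have h1 := (sq_lt_one_iff_abs_lt_one _).2 hy
      have h2 : (x : ℝ) ^ 2 ≤ 1 := pow_le_one₀ x.2.1 x.2.2
      nlinarith [sq_nonneg y, sq_nonneg (x : ℝ)]
    have h3 : 0 ≤ y ^ 2 * (x : ℝ) ^ 2 := by positivity
    refine mul_pos (by linarith) ?_
    nlinarith [mul_nonneg hs.le h3, mul_nonneg hr.le (sub_nonneg.2 h1.le)]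
  set E := (ContinuousMap.evalCLM ℝ (⟨1, zero_le_one, le_rfl⟩ : Icc (0 : ℝ) 1)).comp
    (prim zero_le_one) with hE
  have h1 : AnalyticAt ℝ (fun u => u.2.2 * E (R (f u))) (r, s, y) :=
    (contDiff_snd.snd.contDiffAt (n := ω)).analyticAt.mul
      ((E.analyticAt _).comp (hR.comp hfc.contDiffAt.analyticAt))
  refine h1.congr ?_
  have e1 : ∀ᶠ u : ℝ × ℝ × ℝ in 𝓝 (r, s, y), 0 < u.1 :=
    continuous_fst.continuousAt.eventually (lt_mem_nhds hr)
  have e2 : ∀ᶠ u : ℝ × ℝ × ℝ in 𝓝 (r, s, y), 0 < u.2.1 :=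
    continuous_snd.fst.continuousAt.eventually (lt_mem_nhds hs)
  have e3 : ∀ᶠ u : ℝ × ℝ × ℝ in 𝓝 (r, s, y), |u.2.2| < 1 :=
    continuous_snd.snd.abs.continuousAt.eventually (gt_mem_nhds hy)
  filter_upwards [hfc.continuous.continuousAt.eventually hRf, e1, e2, e3] with u hu h1 h2 h3
  rw [perB_eq h1 h2 h3]
  congr 1
  exact prim_apply_eq_integral zero_le_one (R (f u)) (fun x => by rw [hu, hfx]) _

/-- With radicands `a ≤ b ≤ M = 2r' + s`, the gap is `(b - a)/(√a √b (√a + √b))` and `b - a ≥ r' -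
r`. The constant depends only on the larger parameter `r'` and on `s`, which later bounds all left
slopes at one point. -/
theorem ker_add_le (hr : 0 < r) (hrr : r ≤ r') (hs : 0 < s) (σ : ℝ) :
    ker r' s σ + (r' - r) / (2 * ((2 * r' + s) * √(2 * r' + s))) ≤ ker r s σ := by
  have ha := ker_radicand_pos hr hs σ
  have hb := ker_radicand_pos (hr.trans_le hrr) hs σ
  have hx0 := sq_nonneg (Real.sin σ)
  have hx1 := Real.sin_sq_le_one σ
  unfold ker
  set x := Real.sin σ ^ 2
  set a := 2 * r + (s - r) * x with hadef
  set b := 2 * r' + (s - r') * x with hbdef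
  have hba : r' - r ≤ b - a := by
    have : b - a = (r' - r) * (2 - x) := by rw [hadef, hbdef]; ring
    rw [this]
    nlinarith [sub_nonneg.2 hrr]
  have hbM : b ≤ 2 * r' + s := by
    have : 0 ≤ r' * x := mul_nonneg (hr.le.trans hrr) hx0
    nlinarith
  set M := 2 * r' + s
  have hM : 0 < M := hb.trans_le hbM
  have hab : a ≤ b := by linarith
  have h1 := Real.sq_sqrt ha.le
  have h2 := Real.sq_sqrt hb.le
  have h3 := Real.sq_sqrt hM.le
  have p1 := Real.sqrt_pos.2 ha
  have p2 := Real.sqrt_pos.2 hb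
  have p3 := Real.sqrt_pos.2 hM
  have q1 := Real.sqrt_le_sqrt hab
  have q2 := Real.sqrt_le_sqrt hbM
  have e : 1 / √a - 1 / √b = (b - a) / ((√a * √b) * (√a + √b)) := by
    field_simp
    nlinarith
  have h : (r' - r) / (2 * (M * √M)) ≤ (b - a) / ((√a * √b) * (√a + √b)) := by
    refine div_le_div₀ (by linarith) hba (by positivity) ?_
    calc (√a * √b) * (√a + √b) ≤ (√M * √M) * (√M + √M) := by gcongr <;> linarith
      _ = 2 * (M * √M) := by rw [Real.mul_self_sqrt hM.le]; ring
  linarith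

theorem ker_antitone (hr : 0 < r) (hrr : r ≤ r') (hs : 0 < s) (σ : ℝ) :
    ker r' s σ ≤ ker r s σ := by
  have := ker_add_le hr hrr hs σ
  have hM : 0 < 2 * r' + s := by linarith
  have : 0 ≤ (r' - r) / (2 * ((2 * r' + s) * √(2 * r' + s))) :=
    div_nonneg (by linarith) (by positivity)
  linarith

/-- The interval of integration has length `π/2 ≥ 1`, so the pointwise gap survives with the same
constant. -/
theorem perA_add_le (hr : 0 < r) (hrr : r ≤ r') (hs : 0 < s) :
    perA r' s + (r' - r) / (2 * ((2 * r' + s) * √(2 * r' + s))) ≤ perA r s := by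
  have hM : 0 < 2 * r' + s := by linarith
  have hc : 0 ≤ (r' - r) / (2 * ((2 * r' + s) * √(2 * r' + s))) :=
    div_nonneg (by linarith) (by positivity)
  set c := (r' - r) / (2 * ((2 * r' + s) * √(2 * r' + s))) with hcdef
  have hi := (continuous_ker (hr.trans_le hrr) hs).intervalIntegrable (μ := volume) 0 (Real.pi / 2)
  have h := intervalIntegral.integral_mono_on (μ := volume) (a := 0) (b := Real.pi / 2)
    (f := fun σ => ker r' s σ + c) (g := ker r s) (by positivity)
    (hi.add intervalIntegrable_const)
    ((continuous_ker hr hs).intervalIntegrable _ _) fun σ _ => ker_add_le hr hrr hs σ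
  rw [intervalIntegral.integral_add hi intervalIntegrable_const,
    intervalIntegral.integral_const, smul_eq_mul] at h
  have hpi := Real.two_le_pi
  unfold perA
  nlinarith

theorem crestSin_facts (hr : r < s) :
    0 ≤ crestSin r s Z ∧ crestSin r s Z ≤ 1 ∧ (0 < Z → crestSin r s Z < 1) := by
  have h : 0 < s - r := by linarith
  refine ⟨Real.sqrt_nonneg _, ?_, fun hZ => ?_⟩
  · refine Real.sqrt_le_one.2 ((div_le_one h).2 ?_)
    nlinarith [sq_nonneg Z]
  · rw [crestSin, Real.sqrt_lt' one_pos, one_pow, div_lt_one h]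
    nlinarith

theorem crestSin_antitone (hrr : r ≤ r') (hr : r' < s) :
    crestSin r' s Z ≤ crestSin r s Z := by
  have h1 : 0 < s - r := by linarith
  have h2 : 0 < s - r' := by linarith
  refine Real.sqrt_le_sqrt ?_
  rw [div_le_div_iff₀ h2 h1]
  nlinarith [sq_nonneg Z, mul_nonneg (sub_nonneg.2 hrr) (sq_nonneg Z)]

theorem integral_ker_mono {α β : ℝ} (hr : 0 < r) (hs : 0 < s) (hαβ : α ≤ β) :
    ∫ σ in (0 : ℝ)..α, ker r s σ ≤ ∫ σ in (0 : ℝ)..β, ker r s σ :=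
  (monotone_of_hasDerivAt_nonneg (hasDerivAt_integral_ker hr hs) fun t => (ker_pos hr hs t).le) hαβ

/-- Raising `r` lowers the integrand of both parts and the upper limit of the second; the gap from
`perA` alone is enough. -/
theorem perG_add_le (hr : 0 < r) (hrr : r ≤ r') (hs : r' < s) :
    perG r' s Z + (r' - r) / (2 * ((2 * r' + s) * √(2 * r' + s))) ≤ perG r s Z := by
  have hs0 : 0 < s := by linarith
  have hr' := hr.trans_le hrr
  have h1 := perA_add_le hr hrr hs0
  have h2 : perB r' s (crestSin r' s Z) ≤ perB r s (crestSin r' s Z) :=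
    intervalIntegral.integral_mono_on (Real.arcsin_nonneg.2 (Real.sqrt_nonneg _))
      ((continuous_ker hr' hs0).intervalIntegrable _ _)
      ((continuous_ker hr hs0).intervalIntegrable _ _) fun σ _ => ker_antitone hr hrr hs0 σ
  have h3 : perB r s (crestSin r' s Z) ≤ perB r s (crestSin r s Z) :=
    integral_ker_mono hr hs0 (Real.monotone_arcsin (crestSin_antitone hrr hs))
  unfold perG
  linarith

theorem perG_strictAnti (hr : 0 < r) (hrr : r < r') (hs : r' < s) : perG r' s Z < perG r s Z := by
  have := perG_add_le (Z := Z) hr hrr.le hs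
  have hM : 0 < 2 * r' + s := by linarith
  have : 0 < (r' - r) / (2 * ((2 * r' + s) * √(2 * r' + s))) :=
    div_pos (by linarith) (by positivity)
  linarith

theorem perA_le (hr : 0 < r) (hs : r ≤ s) : perA r s ≤ Real.pi / 2 / √(2 * r) := by
  have hs0 : 0 < s := by linarith
  have h := intervalIntegral.integral_mono_on (μ := volume) (a := 0) (b := Real.pi / 2)
    (f := ker r s) (g := fun _ => 1 / √(2 * r)) (by positivity)
    ((continuous_ker hr hs0).intervalIntegrable _ _) intervalIntegrable_const fun σ _ => by
      unfold ker
      have := mul_nonneg (sub_nonneg.2 hs) (sq_nonneg (Real.sin σ))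
      gcongr
      linarith
  rw [intervalIntegral.integral_const, smul_eq_mul] at h
  unfold perA
  refine h.trans (le_of_eq ?_)
  ring

theorem perG_le_two_mul_perA (hr : 0 < r) (hs : 0 < s) : perG r s Z ≤ 2 * perA r s := by
  have : perB r s (crestSin r s Z) ≤ perA r s :=
    integral_ker_mono hr hs (Real.arcsin_le_pi_div_two _)
  unfold perG
  linarith

theorem perA_le_perG (hr : 0 < r) (hs : 0 < s) : perA r s ≤ perG r s Z := by
  have : 0 ≤ perB r s (crestSin r s Z) := by
    have := integral_ker_mono hr hs (Real.arcsin_nonneg.2 (Real.sqrt_nonneg _) :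
      0 ≤ Real.arcsin (crestSin r s Z))
    rwa [intervalIntegral.integral_same] at this
  unfold perG
  linarith

/-- Since `sin² σ ≤ σ²`, the root of the radicand is at most `√(2r) + √S σ`. Integrating the
reciprocal over `[0, 1]` gives a logarithm that diverges as `r → 0`, uniformly in `s ≤ S`. -/
theorem exists_forall_lt_perA {S : ℝ} (hS : 0 < S) (M : ℝ) :
    ∃ δ > 0, ∀ r s, 0 < r → r < δ → r ≤ s → s ≤ S → M < perA r s := by
  -- Chosen so that `log (√S / ε) / √S = M`; the condition `r < ε² / 2` then means `√(2r) < ε`.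
  set ε := √S * Real.exp (-(M * √S)) with hε
  have hS' := Real.sqrt_pos.2 hS
  have hεpos : 0 < ε := by positivity
  refine ⟨ε ^ 2 / 2, by positivity, fun r s hr hrδ hrs hsS => ?_⟩
  have hs0 : 0 < s := by linarith
  have hr2 : 0 < √(2 * r) := by positivity
  have hlt : √(2 * r) < ε := by
    rw [Real.sqrt_lt' hεpos]
    linarith
  set e := √(2 * r) with he
  have hpos : ∀ σ : ℝ, 0 ≤ σ → 0 < e + √S * σ := fun σ hσ => by positivity
  have hder : ∀ σ ∈ uIcc (0 : ℝ) 1,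
      HasDerivAt (fun σ => Real.log (e + √S * σ) / √S) (1 / (e + √S * σ)) σ := by
    intro σ hσ
    rw [uIcc_of_le zero_le_one] at hσ
    have := ((((hasDerivAt_id σ).const_mul (√S)).const_add e).log (hpos σ hσ.1).ne').div_const (√S)
    refine this.congr_deriv ?_
    simp only [id]
    field_simp
  have hcont : ContinuousOn (fun σ : ℝ => 1 / (e + √S * σ)) (uIcc 0 1) := by
    refine ContinuousOn.div (by fun_prop) (by fun_prop) fun σ hσ => ?_
    rw [uIcc_of_le zero_le_one] at hσ
    exact (hpos σ hσ.1).ne'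
  have hint := intervalIntegral.integral_eq_sub_of_hasDerivAt hder hcont.intervalIntegrable
  have hmono := intervalIntegral.integral_mono_on (μ := volume) (a := 0) (b := 1)
    (g := ker r s) zero_le_one hcont.intervalIntegrable
    ((continuous_ker hr hs0).intervalIntegrable _ _) fun σ hσ => by
      unfold ker
      have h0 := ker_radicand_pos hr hs0 σ
      refine one_div_le_one_div_of_le (Real.sqrt_pos.2 h0) ?_
      rw [Real.sqrt_le_iff]
      refine ⟨(hpos σ hσ.1).le, ?_⟩
      have h1 : Real.sin σ ^ 2 ≤ σ ^ 2 := Real.sin_sq_le_sq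
      have h2 : (s - r) * Real.sin σ ^ 2 ≤ S * σ ^ 2 :=
        mul_le_mul (by linarith) h1 (sq_nonneg _) hS.le
      have h3 := Real.sq_sqrt hS.le
      have h4 : e ^ 2 = 2 * r := Real.sq_sqrt (by positivity)
      have h5 : 0 ≤ e * (√S * σ) := mul_nonneg hr2.le (mul_nonneg hS'.le hσ.1)
      calc _ ≤ e ^ 2 + √S ^ 2 * σ ^ 2 := by rw [h3, h4]; linarith
        _ ≤ _ := by nlinarith
  have hle : ∫ σ in (0 : ℝ)..1, ker r s σ ≤ perA r s :=
    integral_ker_mono hr hs0 (by linarith [Real.two_le_pi])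
  refine lt_of_lt_of_le ?_ (hmono.trans hle)
  rw [hint, ← sub_div, lt_div_iff₀ hS']
  simp only [mul_one, mul_zero, add_zero]
  have h1 : Real.log e < Real.log (√S) - M * √S := by
    have := Real.log_lt_log hr2 hlt
    rwa [hε, Real.log_mul hS'.ne' (Real.exp_pos _).ne', Real.log_exp, ← sub_eq_add_neg] at this
  have h2 : Real.log (√S) ≤ Real.log (e + √S) := Real.log_le_log hS' (by linarith)
  linarith

theorem analyticAt_perG (hZ : 0 < Z) (hr : 0 < r) (hrs : r < s - Z ^ 2 / 2) :
    AnalyticAt ℝ (fun u : ℝ × ℝ × ℝ => perG u.1 u.2.1 u.2.2) (r, s, Z) := by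
  have hrs' : r < s := by nlinarith
  have hs : 0 < s := by linarith
  obtain ⟨h0, -, h1⟩ := crestSin_facts hrs'
  have hy : |crestSin r s Z| < 1 := by
    rw [abs_of_nonneg h0]
    exact h1 hZ
  have hc : ContDiffAt ℝ ω (fun u : ℝ × ℝ × ℝ => crestSin u.1 u.2.1 u.2.2) (r, s, Z) := by
    unfold crestSin
    refine ContDiffAt.sqrt (ContDiffAt.div (by fun_prop) (by fun_prop) ?_) ?_
    · change s - r ≠ 0
      linarith
    · refine (div_pos ?_ ?_).ne'
      · change 0 < s - r - Z ^ 2 / 2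
        linarith
      · change 0 < s - r
        linarith
  have hA : AnalyticAt ℝ (fun u : ℝ × ℝ × ℝ => perA u.1 u.2.1) (r, s, Z) :=
    (analyticAt_perA hr hs).comp (x := (r, s, Z)) (f := fun u : ℝ × ℝ × ℝ => (u.1, u.2.1))
      (ContDiff.contDiffAt (𝕜 := ℝ) (n := ω) (by fun_prop)).analyticAt
  have hB : AnalyticAt ℝ (fun u : ℝ × ℝ × ℝ => perB u.1 u.2.1 (crestSin u.1 u.2.1 u.2.2))
      (r, s, Z) :=
    (analyticAt_perB hr hs hy).comp
      (x := (r, s, Z)) (f := fun u : ℝ × ℝ × ℝ => (u.1, u.2.1, crestSin u.1 u.2.1 u.2.2))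
      (ContDiffAt.prodMk (by fun_prop) (ContDiffAt.prodMk (by fun_prop) hc)).analyticAt
  exact hA.add hB

/-- Unlike analyticity, this includes the endpoint `r = s - Z²/2`, where the square root in
`crestSin` vanishes; the intermediate value argument needs that endpoint. -/
theorem continuousAt_perG (hZ : 0 < Z) (hr : 0 < r) (hrs : r < s) :
    ContinuousAt (fun r => perG r s Z) r := by
  have hs : 0 < s := by linarith
  obtain ⟨h0, -, h1⟩ := crestSin_facts hrs
  have hy : |crestSin r s Z| < 1 := by
    rw [abs_of_nonneg h0]
    exact h1 hZ
  have hc : ContinuousAt (fun r => crestSin r s Z) r := by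
    unfold crestSin
    refine ContinuousAt.sqrt (ContinuousAt.div (by fun_prop) (by fun_prop) ?_)
    linarith
  have hA : ContinuousAt (fun r => perA r s) r :=
    (analyticAt_perA hr hs).continuousAt.comp (f := fun r => (r, s)) (by fun_prop)
  have hB : ContinuousAt (fun r => perB r s (crestSin r s Z)) r :=
    (analyticAt_perB hr hs hy).continuousAt.comp (f := fun r => (r, s, crestSin r s Z))
      (by fun_prop)
  exact hA.add hB

theorem perG_eq_perA : perG (s - Z ^ 2 / 2) s Z = perA (s - Z ^ 2 / 2) s := by
  simp [perG, crestSin, perB]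

theorem perG_zero (hrs : r < s) : perG r s 0 = 2 * perA r s := by
  have : crestSin r s 0 = 1 := by
    have h : s - r ≠ 0 := by linarith
    simp [crestSin, h]
  rw [perG, this, perB, Real.arcsin_one, ← perA]
  ring

end PeriodIntegral

/-! ### Solution of the period equation, the frequency threshold and the analytic branch. -/

noncomputable section SolutionMap

variable {L r s η ω Z : ℝ}

/-- The lower turning point as a function of `r = 2 η₁ η₂` and `s = η₁² + η₂²`. -/
def etaOf (r s : ℝ) : ℝ := (√(s + r) - √(s - r)) / 2

theorem etaOf_facts (hr : 0 < r) (hrω : r < 2 * ω) :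
    0 < etaOf r (2 * ω) ∧ etaOf r (2 * ω) ^ 2 < ω ∧
      2 * eta1 (etaOf r (2 * ω)) ω * etaOf r (2 * ω) = r := by
  have ha : 0 < 2 * ω + r := by linarith
  have hb : 0 < 2 * ω - r := by linarith
  have ha2 := Real.sq_sqrt ha.le
  have hb2 := Real.sq_sqrt hb.le
  have hb0 := Real.sqrt_pos.2 hb
  have hab : √(2 * ω - r) < √(2 * ω + r) := Real.sqrt_lt_sqrt hb.le (by linarith)
  unfold etaOf
  set a := √(2 * ω + r)
  set b := √(2 * ω - r)
  have he : eta1 ((a - b) / 2) ω = (a + b) / 2 := by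
    rw [eta1, Real.sqrt_eq_iff_mul_self_eq_of_pos (by linarith)]
    linear_combination (ha2 + hb2) / 2
  refine ⟨by linarith, by nlinarith, ?_⟩
  rw [he]
  linear_combination (ha2 - hb2) / 2

theorem etaOf_two_mul_eta1_mul (h0 : 0 < η) (h : η ^ 2 < ω) :
    etaOf (2 * eta1 η ω * η) (2 * ω) = η := by
  have h1 := eta1_sq h
  have h2 := lt_eta1 h
  have e1 : 2 * ω + 2 * eta1 η ω * η = (eta1 η ω + η) ^ 2 := by linear_combination -h1
  have e2 : 2 * ω - 2 * eta1 η ω * η = (eta1 η ω - η) ^ 2 := by linear_combination -h1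
  rw [etaOf, e1, e2, Real.sqrt_sq (by linarith), Real.sqrt_sq (by linarith)]
  ring

theorem perG_eq_of_Tminus_eq (hZ : 0 ≤ Z) (hω : Z ^ 2 / 4 < ω) (hη : η ∈ Ioo 0 (theta ω Z))
    (h : Tminus η ω Z = 2 * L) : perG (2 * eta1 η ω * η) (2 * ω) Z = L / √2 := by
  rw [Tminus_eq hZ hω hη] at h
  have : √2 ≠ (0 : ℝ) := by positivity
  field_simp
  linarith

theorem Tminus_etaOf (hZ : 0 ≤ Z) (hω : Z ^ 2 / 4 < ω) (hr : 0 < r) (hrω : r < 2 * ω - Z ^ 2 / 2)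
    (h : perG r (2 * ω) Z = L / √2) :
    etaOf r (2 * ω) ∈ Ioo 0 (theta ω Z) ∧ Tminus (etaOf r (2 * ω)) ω Z = 2 * L := by
  obtain ⟨h0, h1, h2⟩ := etaOf_facts hr (ω := ω) (by nlinarith)
  have hmem : etaOf r (2 * ω) ∈ Ioo 0 (theta ω Z) :=
    (mem_Ioo_theta_iff hZ hω).2 ⟨h0, h1, by rwa [h2]⟩
  refine ⟨hmem, ?_⟩
  rw [Tminus_eq hZ hω hmem, h2, h]
  have : √2 ≠ (0 : ℝ) := by positivity
  field_simp

/-- `T₋` is strictly decreasing in `r`, and `η` is recovered from `r` through `η₁ ± η = √(2ω ± r)`.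
-/
theorem Tminus_injOn (hZ : 0 ≤ Z) (hω : Z ^ 2 / 4 < ω) :
    InjOn (fun η => Tminus η ω Z) (Ioo 0 (theta ω Z)) := by
  intro η hη η' hη' h
  have h : Tminus η ω Z = Tminus η' ω Z := h
  rw [Tminus_eq hZ hω hη, Tminus_eq hZ hω hη'] at h
  obtain ⟨h0, h1, h2⟩ := (mem_Ioo_theta_iff hZ hω).1 hη
  obtain ⟨h0', h1', h2'⟩ := (mem_Ioo_theta_iff hZ hω).1 hη'
  have hr : 0 < 2 * eta1 η ω * η := by
    have := h0.trans (lt_eta1 h1)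
    positivity
  have hr' : 0 < 2 * eta1 η' ω * η' := by
    have := h0'.trans (lt_eta1 h1')
    positivity
  have hG := mul_left_cancel₀ (by positivity) h
  rw [← etaOf_two_mul_eta1_mul h0 h1, ← etaOf_two_mul_eta1_mul h0' h1']
  rcases lt_trichotomy (2 * eta1 η ω * η) (2 * eta1 η' ω * η') with hlt | heq | hlt
  · exact absurd hG (perG_strictAnti hr hlt (by nlinarith)).ne'
  · rw [heq]
  · exact absurd hG (perG_strictAnti hr' hlt (by nlinarith)).ne

/-- Intermediate values in `r`: the period integral exceeds `L/√2` for small `r`, and at `r = 2ω -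
Z²/2` it equals `T₀/(2√2) < L/√2`. -/
theorem exists_Tminus_eq (hZ : 0 < Z) (hω : Z ^ 2 / 4 < ω) (hT : T0 ω Z < 2 * L) :
    ∃ η ∈ Ioo 0 (theta ω Z), Tminus η ω Z = 2 * L := by
  have h2 : 0 < √(2 : ℝ) := by positivity
  set c := 2 * ω - Z ^ 2 / 2 with hc
  have hc0 : 0 < c := by linarith
  have hcs : c < 2 * ω := by nlinarith
  rw [T0_eq hZ hω, ← perG_eq_perA] at hT
  have hGc : perG c (2 * ω) Z < L / √2 := by
    rw [lt_div_iff₀ h2]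
    linarith
  obtain ⟨δ, hδ, hA⟩ := exists_forall_lt_perA (S := 2 * ω) (by linarith) (L / √2)
  set r₀ := min (δ / 2) (c / 2)
  have hr₀ : 0 < r₀ := by positivity
  have hr₀c : r₀ < c := (min_le_right _ _).trans_lt (by linarith)
  have hr₀δ : r₀ < δ := (min_le_left _ _).trans_lt (by linarith)
  have hG₀ := (hA r₀ (2 * ω) hr₀ hr₀δ (by linarith) le_rfl).trans_le
    (perA_le_perG (Z := Z) hr₀ (by linarith))
  have hcont : ContinuousOn (fun r => perG r (2 * ω) Z) (Icc r₀ c) := fun r hr =>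
    (continuousAt_perG hZ (hr₀.trans_le hr.1) (hr.2.trans_lt hcs)).continuousWithinAt
  obtain ⟨r, hr, hrL⟩ := intermediate_value_Ioo' hr₀c.le hcont ⟨hGc, hG₀⟩
  exact ⟨_, Tminus_etaOf hZ.le hω (hr₀.trans hr.1) hr.2 hrL⟩

theorem perA_self (s : ℝ) : perA s s = Real.pi / 2 / √(2 * s) := by
  have : ker s s = fun _ => 1 / √(2 * s) := by
    funext σ
    simp [ker]
  rw [perA, this, intervalIntegral.integral_const, smul_eq_mul]
  ring

/-- For `r = s` the integrand is constant, and the limiting half period at `Z = 0` is `2 perA (2ω)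
(2ω) = π/(2√ω)`. -/
theorem pi_sq_div_lt_iff (hL : 0 < L) (hω : 0 < ω) :
    Real.pi ^ 2 / (2 * L ^ 2) < ω ↔ 2 * perA (2 * ω) (2 * ω) < L / √2 := by
  have h2 : 0 < √(2 : ℝ) := by positivity
  have hpi := Real.pi_pos
  have e : √(2 * (2 * ω)) = 2 * √ω := by
    rw [← mul_assoc, Real.sqrt_mul (by norm_num),
      show (2 : ℝ) * 2 = 2 ^ 2 by norm_num, Real.sqrt_sq (by norm_num)]
  have hs := Real.sqrt_pos.2 hω
  have hs2 := Real.sq_sqrt hω.le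
  have h22 := Real.sq_sqrt (show (0 : ℝ) ≤ 2 by norm_num)
  rw [perA_self, e, div_lt_iff₀ (by positivity)]
  rw [show 2 * (Real.pi / 2 / (2 * √ω)) = Real.pi / (2 * √ω) by ring,
    div_lt_div_iff₀ (by positivity) h2]
  rw [← pow_lt_pow_iff_left₀ (by positivity : 0 ≤ Real.pi * √2) (by positivity) two_ne_zero]
  rw [mul_pow, mul_pow, mul_pow, hs2, h22]
  constructor <;> intro h <;> linarith

theorem exists_Tminus_zero_iff (hL : 0 < L) (hω : 0 < ω) :
    Real.pi ^ 2 / (2 * L ^ 2) < ω ↔ ∃ η ∈ Ioo 0 (theta ω 0), Tminus η ω 0 = 2 * L := by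
  have hω' : (0 : ℝ) ^ 2 / 4 < ω := by simpa using hω
  rw [pi_sq_div_lt_iff hL hω]
  constructor
  · intro h
    obtain ⟨δ, hδ, hA⟩ := exists_forall_lt_perA (S := 2 * ω) (by linarith) (L / √2)
    set r₀ := min (δ / 2) ω
    have hr₀ : 0 < r₀ := by positivity
    have hr₀c : r₀ < 2 * ω := (min_le_right _ _).trans_lt (by linarith)
    have hr₀δ : r₀ < δ := (min_le_left _ _).trans_lt (by linarith)
    have hG₀ := hA r₀ (2 * ω) hr₀ hr₀δ hr₀c.le le_rfl
    have hLpos : 0 < L / √2 := by positivity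
    have hcont : ContinuousOn (fun r => 2 * perA r (2 * ω)) (Icc r₀ (2 * ω)) := fun r hr =>
      (continuousAt_const.mul ((analyticAt_perA (hr₀.trans_le hr.1)
        (show 0 < 2 * ω by linarith)).continuousAt.comp (f := fun r => (r, 2 * ω))
          (by fun_prop))).continuousWithinAt
    obtain ⟨r, hr, hrL⟩ := intermediate_value_Ioo' hr₀c.le hcont
      (show L / √2 ∈ Ioo _ _ from ⟨h, by linarith⟩)
    refine ⟨_, Tminus_etaOf le_rfl hω' (hr₀.trans hr.1) (by simpa using hr.2) ?_⟩
    rw [perG_zero hr.2]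
    exact hrL
  · rintro ⟨η, hη, hT⟩
    have hG := perG_eq_of_Tminus_eq le_rfl hω' hη hT
    obtain ⟨h0, h1, -, -, -, h2⟩ := param_facts le_rfl hω' hη
    have hr : 0 < 2 * eta1 η ω * η := by
      have := h0.trans h1
      positivity
    have hlt : 2 * eta1 η ω * η < 2 * ω := by simpa using h2
    rw [perG_zero hlt] at hG
    have := perA_add_le hr hlt.le (show 0 < 2 * ω by linarith)
    have : 0 < (2 * ω - 2 * eta1 η ω * η) /
        (2 * ((2 * (2 * ω) + 2 * ω) * √(2 * (2 * ω) + 2 * ω))) :=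
      div_pos (by linarith) (by positivity)
    linarith

/-- Along `r = 2ω - Z²/2`, `s = 2ω` the radicand is `2r + (Z²/2) sin² σ`, which increases with `ω`.
-/
theorem T0_strictAnti (hZ : 0 < Z) {ω' : ℝ} (hω : Z ^ 2 / 4 < ω) (hωω : ω < ω') :
    T0 ω' Z < T0 ω Z := by
  rw [T0_eq hZ hω, T0_eq hZ (hω.trans hωω)]
  refine mul_lt_mul_of_pos_left ?_ (by positivity)
  have hpos : ∀ ω, Z ^ 2 / 4 < ω → 0 < 2 * ω - Z ^ 2 / 2 ∧ 0 < 2 * ω := fun ω h =>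
    ⟨by linarith, by nlinarith⟩
  obtain ⟨h1, h2⟩ := hpos ω hω
  obtain ⟨h3, h4⟩ := hpos ω' (hω.trans hωω)
  have hlt : ∀ σ, ker (2 * ω' - Z ^ 2 / 2) (2 * ω') σ < ker (2 * ω - Z ^ 2 / 2) (2 * ω) σ := by
    intro σ
    have := ker_radicand_pos h1 h2 σ
    refine one_div_lt_one_div_of_lt (Real.sqrt_pos.2 this) (Real.sqrt_lt_sqrt this.le ?_)
    nlinarith
  refine intervalIntegral.integral_lt_integral_of_continuousOn_of_le_of_exists_lt
    (by positivity) (continuous_ker h3 h4).continuousOn (continuous_ker h1 h2).continuousOn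
    (fun σ _ => (hlt σ).le) ⟨0, ⟨le_rfl, by positivity⟩, hlt 0⟩

theorem continuousAt_T0 (hZ : 0 < Z) (hω : Z ^ 2 / 4 < ω) :
    ContinuousAt (fun u : ℝ × ℝ => T0 u.1 u.2) (ω, Z) := by
  have h1 : ContinuousAt (fun u : ℝ × ℝ => 2 * √2 * perA (2 * u.1 - u.2 ^ 2 / 2) (2 * u.1))
      (ω, Z) := by
    refine continuousAt_const.mul ?_
    exact (analyticAt_perA (r := 2 * ω - Z ^ 2 / 2) (s := 2 * ω) (by linarith)
      (by nlinarith)).continuousAt.comp (x := (ω, Z))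
      (f := fun u : ℝ × ℝ => (2 * u.1 - u.2 ^ 2 / 2, 2 * u.1)) (by fun_prop)
  refine h1.congr ?_
  have e1 : ∀ᶠ u : ℝ × ℝ in 𝓝 (ω, Z), 0 < u.2 :=
    continuous_snd.continuousAt.eventually (lt_mem_nhds hZ)
  have e2 : ∀ᶠ u : ℝ × ℝ in 𝓝 (ω, Z), u.2 ^ 2 / 4 < u.1 :=
    ContinuousAt.eventually_lt (by fun_prop) (by fun_prop) hω
  filter_upwards [e1, e2] with u h1 h2
  rw [T0_eq h1 h2]

/-- The frequency at which `T₀` takes the value `2L`. -/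
theorem exists_T0_threshold (hL : 0 < L) (hZ : 0 < Z) :
    ∃ w, Z ^ 2 / 4 < w ∧ ∀ ω, Z ^ 2 / 4 < ω → (T0 ω Z < 2 * L ↔ w < ω) := by
  have h2 : 0 < √(2 : ℝ) := by positivity
  have hZ2 : 0 < Z ^ 2 := by positivity
  obtain ⟨δ, hδ, hA⟩ := exists_forall_lt_perA (S := Z ^ 2 / 2 + 1) (by positivity) (L / √2)
  set t := min (δ / 2) 1
  have ht : 0 < t := by positivity
  have htδ : t < δ := (min_le_left _ _).trans_lt (by linarith)
  have ht1 : t ≤ 1 := min_le_right _ _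
  -- This makes `r = 2ω₁ - Z²/2` equal to the small number `t`, so that `T₀` is large.
  set ω₁ := Z ^ 2 / 4 + t / 2 with hω₁
  have hlow : Z ^ 2 / 4 < ω₁ := by linarith
  have hT₁ : 2 * L < T0 ω₁ Z := by
    have := hA t (2 * ω₁) ht htδ (by linarith) (by linarith)
    rw [div_lt_iff₀ h2] at this
    rw [T0_eq hZ hlow, show 2 * ω₁ - Z ^ 2 / 2 = t by rw [hω₁]; ring]
    linarith
  -- The shift makes `r > 2π²/L²`; `perA_le` then gives `perA < L/4`, hence `T₀ < 2L`.
  set ω₂ := ω₁ + Real.pi ^ 2 / L ^ 2 with hω₂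
  have hpi := Real.pi_pos
  have h12 : ω₁ < ω₂ := by
    have : 0 < Real.pi ^ 2 / L ^ 2 := by positivity
    linarith
  have hT₂ : T0 ω₂ Z < 2 * L := by
    rw [T0_eq hZ (hlow.trans h12)]
    have hR : 2 * (Real.pi ^ 2 / L ^ 2) < 2 * ω₂ - Z ^ 2 / 2 := by linarith
    have hRpos : 0 < Real.pi ^ 2 / L ^ 2 := by positivity
    have h := perA_le (r := 2 * ω₂ - Z ^ 2 / 2) (s := 2 * ω₂) (by linarith) (by linarith)
    have hsq : 2 * (Real.pi / L) < √(2 * (2 * ω₂ - Z ^ 2 / 2)) := by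
      refine Real.lt_sqrt_of_sq_lt ?_
      rw [mul_pow, div_pow]
      linarith
    have h3 : Real.pi / 2 / √(2 * (2 * ω₂ - Z ^ 2 / 2)) < L / 4 := by
      rw [div_lt_iff₀ ((by positivity : 0 < 2 * (Real.pi / L)).trans hsq)]
      have e : L / 4 * (2 * (Real.pi / L)) = Real.pi / 2 := by field_simp; norm_num
      rw [← e]
      exact mul_lt_mul_of_pos_left hsq (by positivity)
    have h4 : √(2 : ℝ) ≤ 2 := Real.sqrt_le_iff.2 (by norm_num)
    nlinarith
  have hcont : ContinuousOn (fun ω => T0 ω Z) (Icc ω₁ ω₂) := fun ω hω =>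
    ((continuousAt_T0 hZ (hlow.trans_le hω.1)).comp (x := ω) (f := fun ω => (ω, Z))
      (by fun_prop)).continuousWithinAt
  obtain ⟨w, hw, hwL⟩ := intermediate_value_Ioo' h12.le hcont ⟨hT₂, hT₁⟩
  have hw0 := hlow.trans hw.1
  refine ⟨w, hw0, fun ω hω => ⟨fun h => ?_, fun h => ?_⟩⟩
  · by_contra! hc
    rcases hc.eq_or_lt with rfl | hc
    · exact h.ne hwL
    · have := T0_strictAnti hZ hω hc
      have hwL : T0 w Z = 2 * L := hwL
      linarith
  · have := T0_strictAnti hZ hw0 h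
    have hwL : T0 w Z = 2 * L := hwL
    linarith

/-- The end point of the frequency range. -/
def freqBound (L Z : ℝ) : ℝ :=
  open Classical in
  if h : 0 < L ∧ 0 < Z then max (exists_T0_threshold h.1 h.2).choose (Real.pi ^ 2 / (2 * L ^ 2))
  else Real.pi ^ 2 / (2 * L ^ 2)

theorem freqBound_zero : freqBound L 0 = Real.pi ^ 2 / (2 * L ^ 2) := by
  simp [freqBound]

theorem lt_freqBound (hL : 0 < L) (hZ : 0 < Z) : Z ^ 2 / 4 < freqBound L Z := by
  rw [freqBound, dif_pos ⟨hL, hZ⟩]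
  exact (exists_T0_threshold hL hZ).choose_spec.1.trans_le (le_max_left _ _)

theorem le_freqBound (hL : 0 < L) (hZ : 0 < Z) : Real.pi ^ 2 / (2 * L ^ 2) ≤ freqBound L Z := by
  rw [freqBound, dif_pos ⟨hL, hZ⟩]
  exact le_max_right _ _

theorem freqBound_lt_iff (hL : 0 < L) (hZ : 0 < Z) :
    freqBound L Z < ω ↔
      Z ^ 2 / 4 < ω ∧ Real.pi ^ 2 / (2 * L ^ 2) < ω ∧ T0 ω Z < 2 * L := by
  obtain ⟨h1, h2⟩ := (exists_T0_threshold hL hZ).choose_spec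
  rw [freqBound, dif_pos ⟨hL, hZ⟩, max_lt_iff]
  constructor
  · rintro ⟨h3, h4⟩
    exact ⟨h1.trans h3, h4, (h2 ω (h1.trans h3)).2 h3⟩
  · rintro ⟨h3, h4, h5⟩
    exact ⟨(h2 ω h3).1 h5, h4⟩

/-- Each of the three conditions that describe `ω > μ(Z)` is open in `(ω, Z)`, so the domain of the
solution map is open without any continuity of `μ`. -/
theorem eventually_freqBound_lt (hL : 0 < L) (hZ : 0 < Z) (hω : freqBound L Z < ω) :
    ∀ᶠ u : ℝ × ℝ in 𝓝 (ω, Z), 0 < u.2 ∧ freqBound L u.2 < u.1 := by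
  obtain ⟨h1, h2, h3⟩ := (freqBound_lt_iff hL hZ).1 hω
  have e1 : ∀ᶠ u : ℝ × ℝ in 𝓝 (ω, Z), 0 < u.2 :=
    continuous_snd.continuousAt.eventually (lt_mem_nhds hZ)
  have e2 : ∀ᶠ u : ℝ × ℝ in 𝓝 (ω, Z), u.2 ^ 2 / 4 < u.1 :=
    ContinuousAt.eventually_lt (by fun_prop) (by fun_prop) h1
  have e3 : ∀ᶠ u : ℝ × ℝ in 𝓝 (ω, Z), Real.pi ^ 2 / (2 * L ^ 2) < u.1 :=
    continuous_fst.continuousAt.eventually (lt_mem_nhds h2)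
  have e4 := (continuousAt_T0 hZ h1).eventually (gt_mem_nhds h3)
  filter_upwards [e1, e2, e3, e4] with u h1 h2 h3 h4
  exact ⟨h1, (freqBound_lt_iff hL h1).2 ⟨h2, h3, h4⟩⟩

/-- The solution map of the period equation. -/
def branch (L ω Z : ℝ) : ℝ :=
  Function.invFunOn (fun η => Tminus η ω Z) (Ioo 0 (theta ω Z)) (2 * L)

theorem branch_spec (hL : 0 < L) (hZ : 0 < Z) (hω : freqBound L Z < ω) :
    branch L ω Z ∈ Ioo 0 (theta ω Z) ∧ Tminus (branch L ω Z) ω Z = 2 * L := by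
  obtain ⟨h1, -, h3⟩ := (freqBound_lt_iff hL hZ).1 hω
  have := exists_Tminus_eq hZ h1 h3
  exact ⟨Function.invFunOn_mem this, Function.invFunOn_eq this⟩

theorem eq_branch (hL : 0 < L) (hZ : 0 < Z) (hω : freqBound L Z < ω)
    (hη : η ∈ Ioo 0 (theta ω Z)) (h : Tminus η ω Z = 2 * L) : η = branch L ω Z := by
  obtain ⟨h1, h2⟩ := branch_spec hL hZ hω
  exact Tminus_injOn hZ.le ((freqBound_lt_iff hL hZ).1 hω).1 hη h1 (h.trans h2.symm)

/-- From `η < η₁` follows `r ≥ 2η²`, and the period integral is at most `2 perA ≤ π/√(2r) ≤ π/(2η)`.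
The bound depends neither on `ω` nor on `Z`. -/
theorem branch_le (hL : 0 < L) (hZ : 0 < Z) (hω : freqBound L Z < ω) :
    branch L ω Z ≤ Real.pi / (√2 * L) := by
  obtain ⟨h1, h2⟩ := branch_spec hL hZ hω
  have hω' := ((freqBound_lt_iff hL hZ).1 hω).1
  have hG := perG_eq_of_Tminus_eq hZ.le hω' h1 h2
  obtain ⟨h0, hp, hs, -, -, hr⟩ := param_facts hZ.le hω' h1
  set η := branch L ω Z
  set p := eta1 η ω
  have hp0 := h0.trans hp
  have hr0 : 0 < 2 * p * η := by positivity
  have hrs : 2 * p * η ≤ 2 * ω := by nlinarith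
  have h3 := perG_le_two_mul_perA (Z := Z) hr0 (show 0 < 2 * ω by linarith)
  have h4 := perA_le hr0 hrs
  have h5 : 2 * η ≤ √(2 * (2 * p * η)) := by
    refine Real.le_sqrt_of_sq_le ?_
    nlinarith
  have hpi := Real.pi_pos
  have h6 : Real.pi / 2 / √(2 * (2 * p * η)) ≤ Real.pi / 2 / (2 * η) := by gcongr
  have h2' : 0 < √(2 : ℝ) := by positivity
  have h22 := Real.mul_self_sqrt (show (0 : ℝ) ≤ 2 by norm_num)
  have h7 : L / √2 ≤ Real.pi / (2 * η) := by
    have e : 2 * (Real.pi / 2 / (2 * η)) = Real.pi / (2 * η) := by ring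
    linarith
  rw [div_le_div_iff₀ h2' (by positivity)] at h7
  rw [le_div_iff₀ (by positivity)]
  nlinarith

/-- Slopes are taken from the left, because the gap constant of `perG_add_le` depends on the larger
argument, here the fixed point `r`. -/
theorem deriv_perG_ne_zero (hZ : 0 < Z) (hr : 0 < r) (hrs : r < s - Z ^ 2 / 2) :
    deriv (fun r => perG r s Z) r ≠ 0 := by
  have hd : DifferentiableAt ℝ (fun r => perG r s Z) r :=
    ((analyticAt_perG hZ hr hrs).differentiableAt).comp (f := fun r => (r, s, Z)) r (by fun_prop)
  have hsub : Iio r ⊆ {r}ᶜ := fun x hx => ne_of_lt hx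
  have hlim := (hasDerivAt_iff_tendsto_slope.1 hd.hasDerivAt).mono_left (nhdsWithin_mono r hsub)
  have hrs' : r < s := by nlinarith
  have hM : 0 < 2 * r + s := by linarith
  set c := 1 / (2 * ((2 * r + s) * √(2 * r + s))) with hc
  have hcpos : 0 < c := by positivity
  have hle : deriv (fun r => perG r s Z) r ≤ -c := by
    refine le_of_tendsto hlim ?_
    filter_upwards [Ioo_mem_nhdsLT hr] with x hx
    have := perG_add_le (Z := Z) hx.1 hx.2.le hrs'
    rw [slope_def_field, div_le_iff_of_neg (by linarith [hx.2])]
    rw [div_eq_mul_one_div, ← hc] at this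
    linarith
  linarith

theorem analyticAt_branch (hL : 0 < L) (hZ : 0 < Z) (hω : freqBound L Z < ω) :
    AnalyticAt ℝ (fun u : ℝ × ℝ => branch L u.1 u.2) (ω, Z) := by
  obtain ⟨h1, h2⟩ := branch_spec hL hZ hω
  have hω' := ((freqBound_lt_iff hL hZ).1 hω).1
  have hG := perG_eq_of_Tminus_eq hZ.le hω' h1 h2
  obtain ⟨h0, hp, hs, -, -, hr⟩ := param_facts hZ.le hω' h1
  have hp0 := h0.trans hp
  set r := 2 * eta1 (branch L ω Z) ω * branch L ω Z with hrdef
  have hr0 : 0 < r := by positivity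
  set f : (ℝ × ℝ) × ℝ → ℝ := fun v => perG v.2 (2 * v.1.1) v.1.2 with hf
  -- The exponent `⊤` in `WithTop ℕ∞` stands for analyticity; the letter `ω` is taken by the
  -- frequency.
  have hfa : ContDiffAt ℝ ⊤ f ((ω, Z), r) := by
    refine AnalyticAt.contDiffAt ?_
    exact (analyticAt_perG hZ hr0 hr).comp (x := ((ω, Z), r))
      (f := fun v : (ℝ × ℝ) × ℝ => (v.2, 2 * v.1.1, v.1.2))
      (ContDiff.contDiffAt (𝕜 := ℝ) (n := ⊤) (by fun_prop)).analyticAt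
  have hd := deriv_perG_ne_zero hZ hr0 hr
  have hinv : (fderiv ℝ f ((ω, Z), r) ∘L .inr ℝ (ℝ × ℝ) ℝ).IsInvertible := by
    have hdiff : DifferentiableAt ℝ (fun r => perG r (2 * ω) Z) r := by
      by_contra hc
      exact hd (deriv_zero_of_not_differentiableAt hc)
    rw [fderiv_comp_inr (hfa.differentiableAt (by simp)) hdiff.hasDerivAt.hasFDerivAt]
    refine ContinuousLinearMap.IsInvertible.of_inverse
      (g := ContinuousLinearMap.toSpanSingleton ℝ (deriv (fun r => perG r (2 * ω) Z) r)⁻¹) ?_ ?_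
    · ext
      simp [hd]
    · ext
      simp [hd]
  have hRa := hfa.contDiffAt_implicitFunction (by simp) hinv
  have hR0 := hfa.implicitFunction_apply_self (by simp) hinv
  have hReq := hfa.eventually_apply_implicitFunction (by simp) hinv
  set R := hfa.implicitFunction (by simp) hinv
  simp only at hRa hR0 hReq
  have e1 : ∀ᶠ u in 𝓝 (ω, Z), 0 < R u :=
    hRa.continuousAt.eventually (lt_mem_nhds (by rwa [hR0]))
  have e2 : ∀ᶠ u : ℝ × ℝ in 𝓝 (ω, Z), R u < 2 * u.1 - u.2 ^ 2 / 2 :=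
    hRa.continuousAt.eventually_lt (by fun_prop) (by rwa [hR0])
  have hrω : r < 2 * ω := by nlinarith
  have han : ContDiffAt ℝ ⊤ (fun u : ℝ × ℝ => etaOf (R u) (2 * u.1)) (ω, Z) := by
    unfold etaOf
    refine ContDiffAt.div_const (ContDiffAt.sub (ContDiffAt.sqrt ?_ ?_)
      (ContDiffAt.sqrt ?_ ?_)) _
    · fun_prop
    · simp only [hR0]
      linarith
    · fun_prop
    · simp only [hR0]
      linarith
  refine han.analyticAt.congr ?_
  filter_upwards [e1, e2, hReq, eventually_freqBound_lt hL hZ hω] with u h1 h2 h3 h4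
  obtain ⟨h5, h6⟩ := h4
  have h7 := ((freqBound_lt_iff hL h5).1 h6).1
  have h8 : perG (R u) (2 * u.1) u.2 = L / √2 := h3.trans hG
  obtain ⟨h9, h10⟩ := Tminus_etaOf h5.le h7 h1 h2 h8
  -- The implicit function yields some solution near the base point; uniqueness of solutions
  -- identifies it with `branch`.
  exact eq_branch hL h5 h6 h9 h10

end SolutionMap

/-! ### The dnoidal peak: equation, regularity and jump. -/

noncomputable section Profile

variable {L η ω Z : ℝ}

/-- The dnoidal wave with phase `c`. -/
def wave (η ω c x : ℝ) : ℝ := eta1 η ω * dn (eta1 η ω / √2 * x + c) (modulus η ω)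

/-- The derivative of the dnoidal wave. -/
def waveDeriv (η ω c x : ℝ) : ℝ :=
  eta1 η ω ^ 2 / √2 * dnDeriv (eta1 η ω / √2 * x + c) (modulus η ω)

theorem hasDerivAt_wave (hk : modulus η ω ^ 2 < 1) (c x : ℝ) :
    HasDerivAt (wave η ω c) (waveDeriv η ω c x) x := by
  have h1 : HasDerivAt (fun x => eta1 η ω / √2 * x + c) (eta1 η ω / √2) x := by
    simpa using ((hasDerivAt_id x).const_mul (eta1 η ω / √2)).add_const c
  have h := ((hasDerivAt_dn hk _).comp x h1).const_mul (eta1 η ω)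
  refine h.congr_deriv ?_
  rw [waveDeriv]
  ring

/-- From `dn'' = (2 - k²) dn - 2 dn³`: the linear coefficient is `η₁²(2 - k²)/2 = (η₁² + η²)/2 = ω`.
-/
theorem hasDerivAt_waveDeriv (hZ : 0 ≤ Z) (hω : Z ^ 2 / 4 < ω) (hη : η ∈ Ioo 0 (theta ω Z))
    (c x : ℝ) :
    HasDerivAt (waveDeriv η ω c) (ω * wave η ω c x - wave η ω c x ^ 3) x := by
  obtain ⟨h0, hp, hs, hk, hk1, -⟩ := param_facts hZ hω hη
  have h1 : HasDerivAt (fun x => eta1 η ω / √2 * x + c) (eta1 η ω / √2) x := by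
    simpa using ((hasDerivAt_id x).const_mul (eta1 η ω / √2)).add_const c
  have h := ((hasDerivAt_dnDeriv hk1 _).comp x h1).const_mul (eta1 η ω ^ 2 / √2)
  refine h.congr_deriv ?_
  have hp0 := h0.trans hp
  have hk2 : eta1 η ω ^ 2 * modulus η ω ^ 2 = eta1 η ω ^ 2 - η ^ 2 := by
    rw [hk]
    field_simp
  have h2 := Real.sq_sqrt (show (0 : ℝ) ≤ 2 by norm_num)
  have e : ∀ q d : ℝ, q / √2 * (d * (q / √2)) = q ^ 2 / 2 * d := by
    intro q d
    field_simp
    rw [h2]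
    ring
  rw [wave]
  set p := eta1 η ω
  set d := dn (p / √2 * x + c) (modulus η ω)
  rw [show p ^ 2 / √2 * (((2 - modulus η ω ^ 2) * d - 2 * d ^ 3) * (p / √2)) =
    p * (p / √2 * (((2 - modulus η ω ^ 2) * d - 2 * d ^ 3) * (p / √2))) by ring, e]
  linear_combination -(p * d / 2) * hk2 + p * d / 2 * hs

theorem contDiff_wave (hk : modulus η ω ^ 2 < 1) (c : ℝ) : ContDiff ℝ 2 (wave η ω c) :=
  contDiff_const.mul ((contDiff_dn hk).comp (by fun_prop))

/-- The distance to `2Lℤ` is the norm on the circle, from which evenness, periodicity and continuity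
of the peak follow. -/
theorem peak_eq_wave_norm (L η ω Z ξ : ℝ) :
    peak L η ω Z ξ = wave η ω (shift η ω Z) ‖(ξ : AddCircle (2 * L))‖ := by
  rw [AddCircle.norm_eq, peak, wave, inv_mul_eq_div, mul_comm (2 * L)]

theorem peak_neg (L η ω Z ξ : ℝ) : peak L η ω Z (-ξ) = peak L η ω Z ξ := by
  rw [peak_eq_wave_norm, peak_eq_wave_norm, AddCircle.coe_neg, norm_neg]

theorem peak_add_period (L η ω Z ξ : ℝ) : peak L η ω Z (ξ + 2 * L) = peak L η ω Z ξ := by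
  rw [peak_eq_wave_norm, peak_eq_wave_norm, AddCircle.coe_add_period]

theorem peak_of_abs_le (hL : 0 < L) {ξ : ℝ} (hξ : |ξ| ≤ L) :
    peak L η ω Z ξ = wave η ω (shift η ω Z) |ξ| := by
  have hL2 : 0 < 2 * L := by positivity
  have h : |ξ| ≤ |2 * L| / 2 := by
    rw [abs_of_pos hL2]
    linarith
  rw [peak_eq_wave_norm, (AddCircle.norm_coe_eq_abs_iff (2 * L) hL2.ne').2 h]

theorem eta1_mul_add_shift (hη : 0 < eta1 η ω) (hT : Tminus η ω Z = 2 * L) :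
    eta1 η ω / √2 * L + shift η ω Z = ellK (modulus η ω) := by
  rw [Tminus] at hT
  have h2 := Real.sq_sqrt (show (0 : ℝ) ≤ 2 by norm_num)
  have h20 : 0 < √(2 : ℝ) := by positivity
  field_simp at hT ⊢
  nlinarith

/-- The period equation puts the point `L` at `K`. Since `dn` is symmetric about `K`, a single wave
describes the peak on a full interval between nodes, and no singularity arises at `ξ = L`. -/
theorem peak_of_mem_Icc (hL : 0 < L) (hk : modulus η ω ^ 2 < 1) (hη : 0 < eta1 η ω)
    (hT : Tminus η ω Z = 2 * L) {ξ : ℝ} (hξ : ξ ∈ Icc 0 (2 * L)) :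
    peak L η ω Z ξ = wave η ω (shift η ω Z) ξ := by
  rcases le_total ξ L with h | h
  · rw [peak_of_abs_le hL (by rwa [abs_of_nonneg hξ.1]), abs_of_nonneg hξ.1]
  · have e : ξ = (ξ - 2 * L) + 2 * L := by ring
    have hle : ξ - 2 * L ≤ 0 := by linarith [hξ.2]
    rw [e, peak_add_period, ← e,
      peak_of_abs_le hL (by rw [abs_of_nonpos hle]; linarith), abs_of_nonpos hle, wave, wave,
      ← dn_two_mul_ellK_sub hk, ← eta1_mul_add_shift hη hT]
    congr 2
    ring

theorem eventually_peak_eq_wave (hL : 0 < L) (hk : modulus η ω ^ 2 < 1) (hη : 0 < eta1 η ω)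
    (hT : Tminus η ω Z = 2 * L) {x : ℝ} (hx : x ∉ nodes L) :
    ∃ c, peak L η ω Z =ᶠ[𝓝 x] wave η ω c := by
  have hL2 : 0 < 2 * L := by positivity
  set n := ⌊x / (2 * L)⌋
  have h1 : (n : ℝ) * (2 * L) ≤ x := (le_div_iff₀ hL2).1 (Int.floor_le _)
  have h2 : x < (n + 1) * (2 * L) := (div_lt_iff₀ hL2).1 (Int.lt_floor_add_one _)
  have h1' : (n : ℝ) * (2 * L) < x := by
    refine lt_of_le_of_ne h1 fun e => hx ⟨n, ?_⟩
    simp only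
    rw [← e]
    ring
  refine ⟨shift η ω Z - eta1 η ω / √2 * (n * (2 * L)), ?_⟩
  filter_upwards [Ioo_mem_nhds h1' h2] with y hy
  have hper : Function.Periodic (peak L η ω Z) (2 * L) := peak_add_period L η ω Z
  rw [← hper.sub_int_mul_eq n, peak_of_mem_Icc hL hk hη hT
    ⟨by linarith [hy.1], by linarith [hy.2]⟩, wave, wave]
  congr 2
  ring

/-- The squared slope at `0` is `(η₁² - Φ²)(Φ² - η²)/2`, which the quartic for `Φ` turns into
`(ZΦ/2)²`. The sign is fixed by the amplitude lying in `[0, π/2]`. -/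
theorem waveDeriv_shift_zero (hZ : 0 ≤ Z) (hω : Z ^ 2 / 4 < ω) (hη : η ∈ Ioo 0 (theta ω Z)) :
    wave η ω (shift η ω Z) 0 = crest η ω Z ∧
      waveDeriv η ω (shift η ω Z) 0 = -(Z / 2 * crest η ω Z) := by
  obtain ⟨h0, hp, hs, hk, hk1, -⟩ := param_facts hZ hω hη
  obtain ⟨hc0, hc1, hc2, heq, -⟩ := crest_facts hZ hω hη
  have hp0 := h0.trans hp
  have hsq : √(1 - modulus η ω ^ 2) = η / eta1 η ω := by
    rw [Real.sqrt_eq_iff_mul_self_eq_of_pos (by positivity), hk]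
    field_simp
    ring
  obtain ⟨hmem, hdn⟩ := arcdn_spec hk1 (y := crest η ω Z / eta1 η ω)
    (by rw [hsq]; gcongr) ((div_le_one hp0).2 hc2)
  have ham := am_mem_Icc hk1 hmem
  have hsin := Real.sin_nonneg_of_nonneg_of_le_pi ham.1 (by linarith [ham.2, Real.pi_pos])
  have hcos := Real.cos_nonneg_of_neg_pi_div_two_le_of_le (by linarith [ham.1, Real.pi_pos]) ham.2
  have hdn2 := dn_sq hk1 (arcdn (crest η ω Z / eta1 η ω) (modulus η ω))
  rw [hdn] at hdn2
  have hsc := Real.sin_sq_add_cos_sq (am (arcdn (crest η ω Z / eta1 η ω) (modulus η ω))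
    (modulus η ω))
  constructor
  · rw [wave, mul_zero, zero_add, shift, hdn]
    field_simp
  · rw [waveDeriv, mul_zero, zero_add, shift, dnDeriv]
    have hk2 : eta1 η ω ^ 2 * modulus η ω ^ 2 = eta1 η ω ^ 2 - η ^ 2 := by
      rw [hk]
      field_simp
    set S := Real.sin (am (arcdn (crest η ω Z / eta1 η ω) (modulus η ω)) (modulus η ω))
    set C := Real.cos (am (arcdn (crest η ω Z / eta1 η ω) (modulus η ω)) (modulus η ω))
    set p := eta1 η ω
    set k := modulus η ω
    set Φ := crest η ω Z
    have e1 : p ^ 2 * k ^ 2 * S ^ 2 = p ^ 2 - Φ ^ 2 := by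
      have : p ^ 2 * (Φ / p) ^ 2 = Φ ^ 2 := by field_simp
      linear_combination -this + p ^ 2 * hdn2
    have e2 : p ^ 2 * k ^ 2 * C ^ 2 = Φ ^ 2 - η ^ 2 := by
      linear_combination p ^ 2 * k ^ 2 * hsc - e1 + hk2
    have h2 := Real.sq_sqrt (show (0 : ℝ) ≤ 2 by norm_num)
    have hX : p ^ 2 / √2 * (k ^ 2 * S * C) = Z / 2 * Φ := by
      refine (pow_left_inj₀ (by positivity) (by positivity) two_ne_zero).1 ?_
      rw [mul_pow, div_pow, h2]
      linear_combination (p ^ 2 * k ^ 2 * C ^ 2 / 2) * e1 + (p ^ 2 - Φ ^ 2) / 2 * e2 +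
        Φ ^ 2 / 2 * hs - heq / 2
    linear_combination -hX

theorem isPeriodicPeak_peak (hL : 0 < L) (hZ : 0 ≤ Z) (hω : Z ^ 2 / 4 < ω)
    (hη : η ∈ Ioo 0 (theta ω Z)) (hT : Tminus η ω Z = 2 * L) :
    IsPeriodicPeak L ω Z (peak L η ω Z) := by
  obtain ⟨h0, hp, hs, -, hk, -⟩ := param_facts hZ hω hη
  have hp0 := h0.trans hp
  have hderiv : ∀ c, deriv (wave η ω c) = waveDeriv η ω c := fun c =>
    funext fun x => (hasDerivAt_wave hk c x).deriv
  have hcontD : Continuous (waveDeriv η ω (shift η ω Z)) :=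
    continuous_iff_continuousAt.2 fun x => (hasDerivAt_waveDeriv hZ hω hη _ x).continuousAt
  refine ⟨fun x => mul_pos hp0 (dn_pos hk _), peak_add_period L η ω Z, ?_, ?_, ?_, ?_⟩
  · have : peak L η ω Z = fun ξ : ℝ => wave η ω (shift η ω Z) ‖(ξ : AddCircle (2 * L))‖ :=
      funext (peak_eq_wave_norm L η ω Z)
    rw [this]
    exact (contDiff_wave hk _).continuous.comp
      (continuous_norm.comp (AddCircle.continuous_mk' (2 * L)))
  · intro x hx
    obtain ⟨c, hc⟩ := eventually_peak_eq_wave hL hk hp0 hT hx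
    exact ((contDiff_wave hk c).contDiffAt.congr_of_eventuallyEq hc).contDiffWithinAt
  · intro x hx
    obtain ⟨c, hc⟩ := eventually_peak_eq_wave hL hk hp0 hT hx
    rw [hc.deriv.deriv_eq, hc.eq_of_nhds, hderiv, (hasDerivAt_waveDeriv hZ hω hη c x).deriv]
    ring
  · obtain ⟨h1, h2⟩ := waveDeriv_shift_zero hZ hω hη
    refine ⟨waveDeriv η ω (shift η ω Z) 0, -waveDeriv η ω (shift η ω Z) 0, ?_, ?_, ?_⟩
    · refine (hcontD.continuousAt.tendsto.mono_left nhdsWithin_le_nhds).congr' ?_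
      filter_upwards [Ioo_mem_nhdsGT (show 0 < 2 * L by positivity)] with x hx
      have : peak L η ω Z =ᶠ[𝓝 x] wave η ω (shift η ω Z) := by
        filter_upwards [Ioo_mem_nhds hx.1 hx.2] with y hy
        exact peak_of_mem_Icc hL hk hp0 hT (Ioo_subset_Icc_self hy)
      rw [this.deriv_eq, hderiv]
    · have hlim : Tendsto (fun x => -waveDeriv η ω (shift η ω Z) (-x)) (𝓝[<] 0)
          (𝓝 (-waveDeriv η ω (shift η ω Z) 0)) := by
        have : Continuous fun x => -waveDeriv η ω (shift η ω Z) (-x) := by fun_prop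
        have h := (this.continuousAt (x := 0)).tendsto
        simp only [neg_zero] at h
        exact h.mono_left nhdsWithin_le_nhds
      refine hlim.congr' ?_
      filter_upwards [Ioo_mem_nhdsLT (show -(2 * L) < 0 by linarith)] with x hx
      have : peak L η ω Z =ᶠ[𝓝 x] fun y => wave η ω (shift η ω Z) (-y) := by
        filter_upwards [Ioo_mem_nhds hx.1 hx.2] with y hy
        rw [← peak_neg]
        exact peak_of_mem_Icc hL hk hp0 hT ⟨by linarith [hy.2], by linarith [hy.1]⟩
      rw [this.deriv_eq, deriv_comp_neg, hderiv]
    · rw [peak_of_abs_le hL (by simpa using hL.le), abs_zero, h1, h2]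
      ring

end Profile

/-! ### Analytic dependence of the peaks in the periodic Sobolev space. -/

noncomputable section Sobolev

variable {L η ω Z : ℝ}

/-- Half a period of the dnoidal peak, started from its minimum, solves the integrated equation. -/
theorem exists_profile (hL : 0 < L) (hZ : 0 ≤ Z) (hω : Z ^ 2 / 4 < ω)
    (hη : η ∈ Ioo 0 (theta ω Z)) (hT : Tminus η ω Z = 2 * L) :
    ∃ ψ : C(Icc (0 : ℝ) L, ℝ), (∀ x, ψ x = wave η ω (shift η ω Z) (L - x)) ∧
      ψ = η • 1 + prim hL.le (prim hL.le (ω • ψ - ψ * ψ * ψ)) := by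
  obtain ⟨h0, hp, -, hk, hk1, -⟩ := param_facts hZ hω hη
  have hp0 := h0.trans hp
  set c := shift η ω Z
  have hwc : Continuous (wave η ω c) := (contDiff_wave hk1 c).continuous
  have hdc : Continuous (waveDeriv η ω c) :=
    continuous_iff_continuousAt.2 fun x => (hasDerivAt_waveDeriv hZ hω hη _ x).continuousAt
  have hsub : ∀ x : ℝ, HasDerivAt (fun x => L - x) (-1) x := fun x => by
    simpa using (hasDerivAt_id x).const_sub L
  have hK : eta1 η ω / √2 * L + c = ellK (modulus η ω) := eta1_mul_add_shift hp0 hT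
  -- At distance `L` from the crest the argument of `dn` is `K`: the profile has its minimum `η`
  -- there with zero slope. These are the initial data of the integrated equation.
  have hwL : wave η ω c L = η := by
    have hsq : √(1 - modulus η ω ^ 2) = η / eta1 η ω := by
      rw [Real.sqrt_eq_iff_mul_self_eq_of_pos (by positivity), hk]
      field_simp
      ring
    rw [wave, hK, dn_ellK hk1, hsq]
    field_simp
  have hdL : waveDeriv η ω c L = 0 := by
    rw [waveDeriv, hK, dnDeriv, am_ellK hk1]
    simp
  refine ⟨⟨fun x => wave η ω c (L - x), by fun_prop⟩, fun x => rfl, ?_⟩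
  set ψ : C(Icc (0 : ℝ) L, ℝ) := ⟨fun x => wave η ω c (L - x), by fun_prop⟩ with hψ
  have h1 : ∀ x, prim hL.le (ω • ψ - ψ * ψ * ψ) x = -waveDeriv η ω c (L - x) := by
    intro x
    rw [prim_apply_eq_integral hL.le _
      (g := fun t => ω * wave η ω c (L - t) - wave η ω c (L - t) ^ 3)
      (fun x => by simp [hψ]; ring)]
    rw [intervalIntegral.integral_eq_sub_of_hasDerivAt
      (f := fun t => -waveDeriv η ω c (L - t)) (fun t _ => ?_)
      (Continuous.intervalIntegrable (by fun_prop) _ _)]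
    · simp [hdL]
    · have := ((hasDerivAt_waveDeriv hZ hω hη c (L - t)).comp t (hsub t)).neg
      refine this.congr_deriv ?_
      ring
  ext x
  rw [ContinuousMap.add_apply, prim_apply_eq_integral hL.le _
    (g := fun t => -waveDeriv η ω c (L - t)) h1]
  rw [intervalIntegral.integral_eq_sub_of_hasDerivAt
    (f := fun t => wave η ω c (L - t)) (fun t _ => ?_)
    (Continuous.intervalIntegrable (by fun_prop) _ _)]
  · simp [hψ, hwL]
  · have := (hasDerivAt_wave hk1 c (L - t)).comp t (hsub t)
    refine this.congr_deriv ?_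
    ring

/-- The solution of the integrated equation depends analytically on its initial value. -/
theorem exists_analyticAt_solution (hL : 0 ≤ L) (ω : ℝ) {η₀ : ℝ} {ψ₀ : C(Icc (0 : ℝ) L, ℝ)}
    (h₀ : ψ₀ = η₀ • 1 + prim hL (prim hL (ω • ψ₀ - ψ₀ * ψ₀ * ψ₀))) :
    ∃ S : ℝ → C(Icc (0 : ℝ) L, ℝ), AnalyticAt ℝ S η₀ ∧
      ∀ᶠ η in 𝓝 η₀, ∀ ψ, ψ = η • 1 + prim hL (prim hL (ω • ψ - ψ * ψ * ψ)) → ψ = S η := by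
  set F : ℝ × C(Icc (0 : ℝ) L, ℝ) → C(Icc (0 : ℝ) L, ℝ) := fun u =>
    u.2 - u.1 • 1 - prim hL (prim hL (ω • u.2 - u.2 * u.2 * u.2)) with hF
  have hcd : ContDiffAt ℝ ⊤ F (η₀, ψ₀) := ContDiff.contDiffAt (by fun_prop)
  -- `q = ω - 3ψ₀²` is the derivative of `ωψ - ψ³` at `ψ₀`, so the linearization is the identity
  -- minus a Volterra operator.
  set q : C(Icc (0 : ℝ) L, ℝ) := ω • 1 - (ψ₀ * ψ₀ + ψ₀ * ψ₀ + ψ₀ * ψ₀) with hq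
  set A := (1 : C(Icc (0 : ℝ) L, ℝ) →L[ℝ] C(Icc (0 : ℝ) L, ℝ)) -
    prim hL ∘L prim hL ∘L ContinuousLinearMap.mul ℝ _ q with hA
  have hder : HasFDerivAt (fun y => F ((η₀, ψ₀).1, y)) A (η₀, ψ₀).2 := by
    have hid := hasFDerivAt_id (𝕜 := ℝ) ψ₀
    have h1 := (hid.const_smul ω).sub ((hid.mul hid).mul hid)
    have h2 := (hid.sub_const (η₀ • (1 : C(Icc (0 : ℝ) L, ℝ)))).sub
      ((prim hL ∘L prim hL).hasFDerivAt.comp ψ₀ h1)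
    refine h2.congr_fderiv ?_
    ext1 y
    simp only [hA, hq, _root_.sub_apply, ContinuousLinearMap.comp_apply,
      ContinuousLinearMap.id_apply, one_apply_eq_self,
      ContinuousLinearMap.mul_apply', _root_.smul_apply,
      _root_.add_apply, id]
    congr 3
    ext x
    simp
    ring
  have hinv : (fderiv ℝ F (η₀, ψ₀) ∘L .inr ℝ ℝ C(Icc (0 : ℝ) L, ℝ)).IsInvertible := by
    rw [fderiv_comp_inr (hcd.differentiableAt (by simp)) hder]
    obtain ⟨u, hu⟩ := isUnit_one_sub_volterra hL q
    refine ContinuousLinearMap.IsInvertible.of_inverse (g := ((u⁻¹ : _ˣ) : _ →L[ℝ] _)) ?_ ?_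
    · rw [hA, ← hu]
      exact u.mul_inv
    · rw [hA, ← hu]
      exact u.inv_mul
  refine ⟨hcd.implicitFunction (by simp) hinv,
    (hcd.contDiffAt_implicitFunction (by simp) hinv).analyticAt, ?_⟩
  filter_upwards [hcd.eventually_apply_implicitFunction (by simp) hinv] with η hη ψ hψ
  set φ := hcd.implicitFunction (by simp) hinv η
  have hF0 : F (η₀, ψ₀) = 0 := by
    rw [sub_eq_zero, sub_eq_iff_eq_add']
    exact h₀
  have hφ : φ = η • 1 + prim hL (prim hL (ω • φ - φ * φ * φ)) := by
    rw [hF0, sub_eq_zero, sub_eq_iff_eq_add'] at hη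
    exact hη
  -- The difference quotient of `ωψ - ψ³` between two solutions. Their difference lies in the kernel
  -- of the identity minus a Volterra operator, so it vanishes; `ψ` need not be close to `ψ₀`.
  set Q : C(Icc (0 : ℝ) L, ℝ) := ω • 1 - (ψ * ψ + ψ * φ + φ * φ) with hQ
  have hz : (1 - prim hL ∘L prim hL ∘L ContinuousLinearMap.mul ℝ _ Q) (ψ - φ) = 0 := by
    have e : ω • ψ - ψ * ψ * ψ - (ω • φ - φ * φ * φ) = Q * (ψ - φ) := by
      ext x
      simp [hQ]
      ring
    have : ψ - φ = prim hL (prim hL (Q * (ψ - φ))) := by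
      rw [← e, map_sub, map_sub]
      conv_lhs => rw [hψ, hφ]
      abel
    change (ψ - φ) - prim hL (prim hL (Q * (ψ - φ))) = 0
    rw [← this, sub_self]
  obtain ⟨u, hu⟩ := isUnit_one_sub_volterra hL Q
  rw [← hu] at hz
  have := congrArg ((u⁻¹ : _ˣ) : C(Icc (0 : ℝ) L, ℝ) →L[ℝ] C(Icc (0 : ℝ) L, ℝ)) hz
  rw [map_zero, ← mul_apply_eq_comp, u.inv_mul, one_apply_eq_self] at this
  exact sub_eq_zero.1 this

theorem memLp_fold (hL : 0 ≤ L) {σ : ℝ → ℝ} (hσ : Measurable σ) (hσ1 : ∀ x, |σ x| ≤ 1)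
    (f : C(Icc (0 : ℝ) L, ℝ)) :
    MemLp (fun x => ((σ x * IccExtend hL f (L - |x|) : ℝ) : ℂ)) 2 (periodMeasure L) := by
  have hf : Continuous (IccExtend hL f) := f.continuous.Icc_extend' (h := hL)
  have hm : Measurable fun x => σ x * IccExtend hL f (L - |x|) :=
    hσ.mul (Continuous.measurable (by fun_prop))
  refine MemLp.of_bound (Complex.measurable_ofReal.comp hm).aestronglyMeasurable ‖f‖
    (Eventually.of_forall fun x => ?_)
  rw [Complex.norm_real, norm_mul]
  calc _ ≤ 1 * ‖f‖ := mul_le_mul (hσ1 x) (f.norm_coe_le_norm _) (norm_nonneg _) zero_le_one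
    _ = ‖f‖ := one_mul _

/-- The class in `L²_per` of the function `x ↦ σ(x) f(L - |x|)`, as an operator on `C([0, L])`. -/
def foldLp (hL : 0 ≤ L) {σ : ℝ → ℝ} (hσ : Measurable σ) (hσ1 : ∀ x, |σ x| ≤ 1) :
    C(Icc (0 : ℝ) L, ℝ) →L[ℝ] L2per L :=
  LinearMap.mkContinuous
    { toFun := fun f => (memLp_fold hL hσ hσ1 f).toLp _
      map_add' := fun f g => by
        rw [← MemLp.toLp_add]
        congr 1
        funext x
        simp only [Pi.add_apply]
        rw [← Complex.ofReal_add, ← mul_add]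
        rfl
      map_smul' := fun c f => by
        rw [RingHom.id_apply, ← MemLp.toLp_const_smul]
        congr 1
        funext x
        simp only [Pi.smul_apply]
        rw [Complex.real_smul, ← Complex.ofReal_mul, mul_left_comm]
        rfl }
    ((measureUnivNNReal (periodMeasure L) : ℝ) ^ (2 : ENNReal).toReal⁻¹) fun f => by
      refine Lp.norm_le_of_ae_bound (norm_nonneg f) ?_
      filter_upwards [(memLp_fold hL hσ hσ1 f).coeFn_toLp] with x hx
      change ‖(memLp_fold hL hσ hσ1 f).toLp _ x‖ ≤ _
      rw [hx, Complex.norm_real, norm_mul]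
      calc _ ≤ 1 * ‖f‖ := mul_le_mul (hσ1 x) (f.norm_coe_le_norm _) (norm_nonneg _) zero_le_one
        _ = ‖f‖ := one_mul _

theorem coeFn_foldLp (hL : 0 ≤ L) {σ : ℝ → ℝ} (hσ : Measurable σ) (hσ1 : ∀ x, |σ x| ≤ 1)
    (f : C(Icc (0 : ℝ) L, ℝ)) :
    (foldLp hL hσ hσ1 f : ℝ → ℂ) =ᵐ[periodMeasure L]
      fun x => ((σ x * IccExtend hL f (L - |x|) : ℝ) : ℂ) :=
  (memLp_fold hL hσ hσ1 f).coeFn_toLp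

/-- The derivative of `x ↦ -|x|`. -/
def negSign (x : ℝ) : ℝ := if x ≤ 0 then 1 else -1

theorem measurable_negSign : Measurable negSign :=
  Measurable.ite measurableSet_Iic measurable_const measurable_const

theorem abs_negSign_le (x : ℝ) : |negSign x| ≤ 1 := by
  unfold negSign
  split_ifs <;> simp

/-- Integration by parts for the even extension of a function on `[0, L]`. -/
theorem integral_deriv_mul_fold (hL : 0 ≤ L) (η : ℝ) (h : C(Icc (0 : ℝ) L, ℝ)) {χ : ℝ → ℝ}
    (hχ : ContDiff ℝ (⊤ : ℕ∞) χ) (hper : Function.Periodic χ (2 * L)) :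
    ∫ x in -L..L, deriv χ x * (1 * IccExtend hL (η • 1 + prim hL h : C(Icc (0 : ℝ) L, ℝ)) (L - |x|)) =
      -∫ x in -L..L, χ x * (negSign x * IccExtend hL h (L - |x|)) := by
  set g := IccExtend hL h with hg
  have hgc : Continuous g := h.continuous.Icc_extend' (h := hL)
  set f : ℝ → ℝ := fun t => η + ∫ s in (0 : ℝ)..t, g s with hf
  have hfd : ∀ t, HasDerivAt f (g t) t := fun t =>
    (hasDerivAt_integral_IccExtend hL h t).const_add η
  have hfc : Continuous f := continuous_iff_continuousAt.2 fun t => (hfd t).continuousAt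
  have hχd : ∀ x, HasDerivAt χ (deriv χ x) x := fun x =>
    (hχ.differentiable (by simp) x).hasDerivAt
  have hχc : Continuous χ := hχ.continuous
  have hχ'c : Continuous (deriv χ) := hχ.continuous_deriv (by simp)
  have hfe : ∀ t ∈ Icc 0 L, IccExtend hL (η • 1 + prim hL h : C(Icc (0 : ℝ) L, ℝ)) t = f t := by
    intro t ht
    rw [IccExtend_of_mem hL _ ht]
    simp [prim_apply, hf, hg]
  -- The boundary terms at `±L` cancel by periodicity of the test function; those at `0` cancel
  -- because both halves take the value `f L` there.
  have hL1 : χ L = χ (-L) := by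
    have := hper (-L)
    rw [← this]
    congr 1
    ring
  have hpos := intervalIntegral.integral_deriv_mul_eq_sub
    (a := 0) (b := L) (u := χ) (v := fun x => f (L - x)) (u' := deriv χ)
    (v' := fun x => -g (L - x)) (fun x _ => hχd x) (fun x _ => by
      have := (hfd (L - x)).comp x ((hasDerivAt_id x).const_sub L)
      simpa [Function.comp_def] using this)
    (hχ'c.intervalIntegrable _ _) (Continuous.intervalIntegrable (by fun_prop) _ _)
  have hneg := intervalIntegral.integral_deriv_mul_eq_sub
    (a := -L) (b := 0) (u := χ) (v := fun x => f (L + x)) (u' := deriv χ)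
    (v' := fun x => g (L + x)) (fun x _ => hχd x) (fun x _ => by
      have := (hfd (L + x)).comp x ((hasDerivAt_id x).const_add L)
      simpa [Function.comp_def] using this)
    (hχ'c.intervalIntegrable _ _) (Continuous.intervalIntegrable (by fun_prop) _ _)
  rw [intervalIntegral.integral_add (Continuous.intervalIntegrable (by fun_prop) _ _)
    (Continuous.intervalIntegrable (by fun_prop) _ _)] at hpos hneg
  have e1 : ∫ x in (0 : ℝ)..L, deriv χ x * (1 * IccExtend hL (η • 1 + prim hL h : C(Icc (0 : ℝ) L, ℝ)) (L - |x|)) =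
      ∫ x in (0 : ℝ)..L, deriv χ x * f (L - x) := by
    refine intervalIntegral.integral_congr fun x hx => ?_
    rw [uIcc_of_le hL] at hx
    simp only [one_mul]
    rw [abs_of_nonneg hx.1, hfe _ ⟨by linarith [hx.2], by linarith [hx.1]⟩]
  have e2 : ∫ x in -L..0, deriv χ x * (1 * IccExtend hL (η • 1 + prim hL h : C(Icc (0 : ℝ) L, ℝ)) (L - |x|)) =
      ∫ x in -L..0, deriv χ x * f (L + x) := by
    refine intervalIntegral.integral_congr fun x hx => ?_
    rw [uIcc_of_le (by linarith)] at hx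
    simp only [one_mul]
    rw [abs_of_nonpos hx.2, sub_neg_eq_add, hfe _ ⟨by linarith [hx.1], by linarith [hx.2]⟩]
  have e3 : ∫ x in (0 : ℝ)..L, χ x * (negSign x * g (L - |x|)) =
      ∫ x in (0 : ℝ)..L, χ x * -g (L - x) := by
    -- `negSign 0 = 1` breaks the formula at the endpoint `0`; the half-open interval leaves this
    -- point out.
    refine intervalIntegral.integral_congr_ae (Eventually.of_forall fun x hx => ?_)
    rw [uIoc_of_le hL] at hx
    rw [abs_of_pos hx.1, negSign, if_neg (not_le.2 hx.1), neg_one_mul]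
  have e4 : ∫ x in -L..0, χ x * (negSign x * g (L - |x|)) =
      ∫ x in -L..0, χ x * g (L + x) := by
    refine intervalIntegral.integral_congr fun x hx => ?_
    rw [uIcc_of_le (by linarith)] at hx
    rw [abs_of_nonpos hx.2, negSign, if_pos hx.2, one_mul, sub_neg_eq_add]
  have hint : ∀ a b, IntervalIntegrable (fun x => χ x * (negSign x * g (L - |x|))) volume a b := by
    intro a b
    have h1 : IntervalIntegrable (fun x => χ x * g (L - |x|)) volume a b :=
      Continuous.intervalIntegrable (by fun_prop) _ _
    refine h1.mono_fun ?_ (Eventually.of_forall fun x => ?_)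
    · exact (hχc.measurable.mul (measurable_negSign.mul
        (Continuous.measurable (by fun_prop)))).aestronglyMeasurable
    · simp only [norm_mul]
      refine mul_le_mul_of_nonneg_left ?_ (norm_nonneg _)
      exact mul_le_of_le_one_left (norm_nonneg _) (abs_negSign_le x)
  have hint' : ∀ a b, IntervalIntegrable
      (fun x => deriv χ x * (1 * IccExtend hL (η • 1 + prim hL h : C(Icc (0 : ℝ) L, ℝ)) (L - |x|))) volume a b := by
    intro a b
    have := ((η • 1 + prim hL h : C(Icc (0 : ℝ) L, ℝ)).continuous.Icc_extend' (h := hL))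
    exact Continuous.intervalIntegrable (by fun_prop) _ _
  rw [← intervalIntegral.integral_add_adjacent_intervals (hint' (-L) 0) (hint' 0 L),
    ← intervalIntegral.integral_add_adjacent_intervals (hint (-L) 0) (hint 0 L), e1, e2, e3, e4]
  simp only [sub_zero, sub_self, add_zero, add_neg_cancel] at hpos hneg
  rw [hL1] at hpos
  linarith

/-- The pair of the even function `x ↦ η + ∫_0^{L - |x|} h` and its derivative. -/
def evenPair (hL : 0 ≤ L) :
    ℝ × C(Icc (0 : ℝ) L, ℝ) →L[ℝ] WithLp 2 (L2per L × L2per L) :=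
  ((WithLp.prodContinuousLinearEquiv 2 ℝ (L2per L) (L2per L)).symm :
      L2per L × L2per L →L[ℝ] WithLp 2 (L2per L × L2per L)) ∘L
    ((foldLp hL (σ := fun _ => 1) measurable_const (fun _ => by simp) ∘L
        ((ContinuousLinearMap.fst ℝ ℝ C(Icc (0 : ℝ) L, ℝ)).smulRight 1 +
          prim hL ∘L ContinuousLinearMap.snd ℝ ℝ C(Icc (0 : ℝ) L, ℝ))).prod
      (foldLp hL measurable_negSign abs_negSign_le ∘L
        ContinuousLinearMap.snd ℝ ℝ C(Icc (0 : ℝ) L, ℝ)))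

theorem evenPair_fst (hL : 0 ≤ L) (v : ℝ × C(Icc (0 : ℝ) L, ℝ)) :
    (evenPair hL v).fst =
      foldLp hL (σ := fun _ => 1) measurable_const (fun _ => by simp) (v.1 • 1 + prim hL v.2) :=
  rfl

theorem evenPair_snd (hL : 0 ≤ L) (v : ℝ × C(Icc (0 : ℝ) L, ℝ)) :
    (evenPair hL v).snd = foldLp hL measurable_negSign abs_negSign_le v.2 := rfl

theorem evenPair_mem (hL : 0 ≤ L) (v : ℝ × C(Icc (0 : ℝ) L, ℝ)) : evenPair hL v ∈ H1per L := by
  intro χ hχ hper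
  have h1 : ∫ x, (deriv χ x : ℝ) • (evenPair hL v).fst x ∂(periodMeasure L) =
      ((∫ x in -L..L, deriv χ x * (1 * IccExtend hL (v.1 • 1 + prim hL v.2 : C(Icc (0 : ℝ) L, ℝ)) (L - |x|)) : ℝ) : ℂ) := by
    rw [← intervalIntegral.integral_ofReal, intervalIntegral.integral_of_le (by linarith), evenPair_fst]
    refine integral_congr_ae ?_
    filter_upwards [coeFn_foldLp hL (σ := fun _ => 1) measurable_const (fun _ => by simp)
      (v.1 • 1 + prim hL v.2)] with x hx
    rw [hx, Complex.real_smul, ← Complex.ofReal_mul]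
  have h2 : ∫ x, (χ x : ℝ) • (evenPair hL v).snd x ∂(periodMeasure L) =
      ((∫ x in -L..L, χ x * (negSign x * IccExtend hL v.2 (L - |x|)) : ℝ) : ℂ) := by
    rw [← intervalIntegral.integral_ofReal, intervalIntegral.integral_of_le (by linarith), evenPair_snd]
    refine integral_congr_ae ?_
    filter_upwards [coeFn_foldLp hL measurable_negSign abs_negSign_le v.2] with x hx
    rw [hx, Complex.real_smul, ← Complex.ofReal_mul]
  rw [h1, h2, integral_deriv_mul_fold hL v.1 v.2 hχ hper, Complex.ofReal_neg]

/-- `evenPair` as an operator into `H¹_per`. -/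
def evenH1 (hL : 0 ≤ L) : ℝ × C(Icc (0 : ℝ) L, ℝ) →L[ℝ] H1per L :=
  (evenPair hL).codRestrict (H1per L) (evenPair_mem hL)

theorem represents_evenH1 (hL : 0 < L) {ψ h : C(Icc (0 : ℝ) L, ℝ)}
    (hψ : ∀ x, ψ x = wave η ω (shift η ω Z) (L - x)) (hψh : ψ = η • 1 + prim hL.le h) :
    Represents (evenH1 hL.le (η, h)) (peak L η ω Z) := by
  change ((evenPair hL.le (η, h)).fst : ℝ → ℂ) =ᵐ[periodMeasure L] _
  rw [evenPair_fst]
  filter_upwards [coeFn_foldLp hL.le (σ := fun _ => 1) measurable_const (fun _ => by simp)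
    (η • 1 + prim hL.le h), ae_restrict_mem measurableSet_Ioc] with x hx hxL
  rw [hx]
  have habs : |x| ≤ L := abs_le.2 ⟨hxL.1.le, hxL.2⟩
  rw [peak_of_abs_le hL habs, one_mul, ← hψh,
    IccExtend_of_mem hL.le _ ⟨by linarith, by linarith [abs_nonneg x]⟩, hψ]
  simp

/-- With `ω` fixed, the profile measured from its minimum is a function of `η` alone. Near each `Z`
it is the analytic solution map evaluated at the analytic branch `Λ(ω, Z)`, followed by bounded
linear and polynomial maps. -/
theorem exists_analyticOnNhd_peak (hL : 0 < L) (ω : ℝ) :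
    ∃ Ψ : ℝ → H1per L,
      (∀ Z, 0 < Z → freqBound L Z < ω → Represents (Ψ Z) (peak L (branch L ω Z) ω Z)) ∧
      AnalyticOnNhd ℝ Ψ {Z | 0 < Z ∧ freqBound L Z < ω} := by
  have hex : ∀ Z, 0 < Z → freqBound L Z < ω → ∃ ψ : C(Icc (0 : ℝ) L, ℝ),
      (∀ x, ψ x = wave (branch L ω Z) ω (shift (branch L ω Z) ω Z) (L - x)) ∧
      ψ = branch L ω Z • 1 + prim hL.le (prim hL.le (ω • ψ - ψ * ψ * ψ)) := fun Z hZ hω =>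
    exists_profile hL hZ.le ((freqBound_lt_iff hL hZ).1 hω).1 (branch_spec hL hZ hω).1
      (branch_spec hL hZ hω).2
  choose! ψ hψ1 hψ2 using hex
  refine ⟨fun Z => evenH1 hL.le
    (branch L ω Z, prim hL.le (ω • ψ Z - ψ Z * ψ Z * ψ Z)), fun Z hZ hω =>
      represents_evenH1 hL (hψ1 Z hZ hω) (hψ2 Z hZ hω), ?_⟩
  rintro Z ⟨hZ, hω⟩
  obtain ⟨S, hS, hSeq⟩ := exists_analyticAt_solution hL.le ω (hψ2 Z hZ hω)
  have hb : AnalyticAt ℝ (fun Z => branch L ω Z) Z :=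
    (analyticAt_branch hL hZ hω).comp (x := Z) (f := fun Z => (ω, Z))
      (ContDiff.contDiffAt (𝕜 := ℝ) (n := ⊤) (by fun_prop)).analyticAt
  have hSb : AnalyticAt ℝ (fun Z => S (branch L ω Z)) Z :=
    hS.comp (x := Z) (f := fun Z => branch L ω Z) hb
  have hP : ContDiff ℝ ⊤ fun φ : C(Icc (0 : ℝ) L, ℝ) => prim hL.le (ω • φ - φ * φ * φ) := by
    fun_prop
  have hPS : AnalyticAt ℝ (fun Z => prim hL.le (ω • S (branch L ω Z) -
      S (branch L ω Z) * S (branch L ω Z) * S (branch L ω Z))) Z :=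
    hP.contDiffAt.analyticAt.comp (x := Z) (f := fun Z => S (branch L ω Z)) hSb
  have hM := ((evenH1 hL.le).analyticAt _).comp (x := Z) (f := fun Z => (branch L ω Z,
    prim hL.le (ω • S (branch L ω Z) - S (branch L ω Z) * S (branch L ω Z) * S (branch L ω Z))))
    (hb.prod hPS)
  refine hM.congr ?_
  have hev : ∀ᶠ Z' in 𝓝 Z, 0 < Z' ∧ freqBound L Z' < ω :=
    (Continuous.tendsto (f := fun Z' : ℝ => (ω, Z')) (by fun_prop) Z).eventually
      (eventually_freqBound_lt hL hZ hω)
  filter_upwards [hev, hb.continuousAt.eventually hSeq] with Z' h1 h2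
  simp only [Function.comp]
  rw [← h2 _ (hψ2 Z' h1.1 h1.2)]

end Sobolev

end DnoidalPeak

/-! ### The family of dnoidal peaks: proof of the theorem. -/

theorem theorem5p3 (L Z₀ ω₀ : ℝ) (hL : 0 < L) (hZ₀ : 0 < Z₀)
    (hω₀ : Z₀ ^ 2 / 4 < ω₀) (hT₀ : DnoidalPeak.T0 ω₀ Z₀ < 2 * L)
    (hω₀L : Real.pi ^ 2 / (2 * L ^ 2) < ω₀) :
    ∃ η₂₀ : ℝ,
      -- the unique solution of the period equation at the base point
      (η₂₀ ∈ Ioo 0 (DnoidalPeak.theta ω₀ Z₀) ∧ DnoidalPeak.Tminus η₂₀ ω₀ Z₀ = 2 * L ∧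
        ∀ η ∈ Ioo 0 (DnoidalPeak.theta ω₀ Z₀),
          DnoidalPeak.Tminus η ω₀ Z₀ = 2 * L → η = η₂₀) ∧
      ∃ (μ : ℝ → ℝ) (Λ : ℝ → ℝ → ℝ),
        Λ ω₀ Z₀ = η₂₀ ∧
        -- the end point `μ(Z, L)` of the frequency range
        μ 0 = Real.pi ^ 2 / (2 * L ^ 2) ∧
        (∀ ω, 0 < ω → (μ 0 < ω ↔
          ∃ η ∈ Ioo 0 (DnoidalPeak.theta ω 0), DnoidalPeak.Tminus η ω 0 = 2 * L)) ∧
        (∀ Z, 0 < Z → Z ^ 2 / 4 < μ Z ∧ Real.pi ^ 2 / (2 * L ^ 2) ≤ μ Z ∧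
          ∀ ω, μ Z < ω ↔
            (Z ^ 2 / 4 < ω ∧ Real.pi ^ 2 / (2 * L ^ 2) < ω ∧ DnoidalPeak.T0 ω Z < 2 * L)) ∧
        -- `Λ` is smooth, and it is the only solution of the period equation
        (∀ ω Z, 0 < Z → μ Z < ω →
          ContDiffAt ℝ (⊤ : ℕ∞) (fun p : ℝ × ℝ => Λ p.1 p.2) (ω, Z) ∧
          Λ ω Z ∈ Ioo 0 (DnoidalPeak.theta ω Z) ∧
          DnoidalPeak.Tminus (Λ ω Z) ω Z = 2 * L ∧
          ∀ η ∈ Ioo 0 (DnoidalPeak.theta ω Z),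
            DnoidalPeak.Tminus η ω Z = 2 * L → η = Λ ω Z) ∧
        -- rectangles `(m, ∞) × (z₁, z₂)` around `(ω₀, Z₀)` that `Λ` maps to `(n₁, n₂)`
        (∀ m, μ Z₀ < m → m < ω₀ →
          ∃ z₁ z₂ n₁ n₂ : ℝ, 0 < z₁ ∧ Z₀ ∈ Ioo z₁ z₂ ∧ η₂₀ ∈ Ioo n₁ n₂ ∧
            ∀ ω ∈ Ioi m, ∀ Z ∈ Ioo z₁ z₂, μ Z < ω ∧ Λ ω Z ∈ Ioo n₁ n₂) ∧
        -- the dnoidal peaks solve the equation with the jump condition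
        (∀ ω Z, 0 < Z → μ Z < ω →
          DnoidalPeak.IsPeriodicPeak L ω Z (DnoidalPeak.peak L (Λ ω Z) ω Z) ∧
          ∀ ξ, DnoidalPeak.peak L (Λ ω Z) ω Z (-ξ) = DnoidalPeak.peak L (Λ ω Z) ω Z ξ) ∧
        -- `Z ↦ φ_{ω,Z} ∈ H¹_per` is real-analytic
        (∀ ω, ∃ Ψ : ℝ → DnoidalPeak.H1per L,
          (∀ Z, 0 < Z → μ Z < ω →
            DnoidalPeak.Represents (Ψ Z) (DnoidalPeak.peak L (Λ ω Z) ω Z)) ∧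
          AnalyticOnNhd ℝ Ψ {Z | 0 < Z ∧ μ Z < ω}) := by
  have hω₀' : DnoidalPeak.freqBound L Z₀ < ω₀ :=
    (DnoidalPeak.freqBound_lt_iff hL hZ₀).2 ⟨hω₀, hω₀L, hT₀⟩
  have hspec := DnoidalPeak.branch_spec hL hZ₀ hω₀'
  refine ⟨DnoidalPeak.branch L ω₀ Z₀,
    ⟨hspec.1, hspec.2, fun η hη h => DnoidalPeak.eq_branch hL hZ₀ hω₀' hη h⟩,
    DnoidalPeak.freqBound L, DnoidalPeak.branch L, rfl, DnoidalPeak.freqBound_zero, ?_, ?_, ?_,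
    ?_, ?_, fun ω => DnoidalPeak.exists_analyticOnNhd_peak hL ω⟩
  · intro ω hω
    rw [DnoidalPeak.freqBound_zero]
    exact DnoidalPeak.exists_Tminus_zero_iff hL hω
  · intro Z hZ
    exact ⟨DnoidalPeak.lt_freqBound hL hZ, DnoidalPeak.le_freqBound hL hZ,
      fun ω => DnoidalPeak.freqBound_lt_iff hL hZ⟩
  · intro ω Z hZ hω
    obtain ⟨h1, h2⟩ := DnoidalPeak.branch_spec hL hZ hω
    exact ⟨(DnoidalPeak.analyticAt_branch hL hZ hω).contDiffAt, h1, h2,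
      fun η hη h => DnoidalPeak.eq_branch hL hZ hω hη h⟩
  · intro m hm hmω
    -- Openness is used at `(m, Z₀)` rather than at `(ω₀, Z₀)`: `μ(Z) < m` then holds near `Z₀` and
    -- serves every `ω > m` at once.
    have hev : ∀ᶠ Z in 𝓝 Z₀, 0 < Z ∧ DnoidalPeak.freqBound L Z < m :=
      (Continuous.tendsto (f := fun Z : ℝ => (m, Z)) (by fun_prop) Z₀).eventually
        (DnoidalPeak.eventually_freqBound_lt hL hZ₀ hm)
    obtain ⟨ε, hε, hball⟩ := Metric.eventually_nhds_iff.1 hev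
    have hz₁ : 0 < max (Z₀ - ε) (Z₀ / 2) := lt_max_of_lt_right (by linarith)
    -- The term `Z₀ / 2` keeps the interval in `(0, ∞)`. The interval `N` goes from `0` to the
    -- uniform bound on the branch, with `1` added to make the inequality strict.
    refine ⟨max (Z₀ - ε) (Z₀ / 2), Z₀ + ε, 0, Real.pi / (√2 * L) + 1, hz₁,
      ⟨max_lt (by linarith) (by linarith), by linarith⟩, ⟨hspec.1.1, ?_⟩, ?_⟩
    · have := DnoidalPeak.branch_le hL hZ₀ hω₀'
      linarith
    · intro ω hω Z hZ
      have hZm := hball (y := Z) (by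
        rw [Real.dist_eq, abs_lt]
        constructor
        · linarith [(le_max_left (Z₀ - ε) (Z₀ / 2)).trans_lt hZ.1]
        · linarith [hZ.2])
      have hlt := hZm.2.trans hω
      have := DnoidalPeak.branch_le hL hZm.1 hlt
      exact ⟨hlt, (DnoidalPeak.branch_spec hL hZm.1 hlt).1.1, by linarith⟩
  · intro ω Z hZ hω
    obtain ⟨h1, h2⟩ := DnoidalPeak.branch_spec hL hZ hω
    exact ⟨DnoidalPeak.isPeriodicPeak_peak hL hZ.le
      ((DnoidalPeak.freqBound_lt_iff hL hZ).1 hω).1 h1 h2,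
      fun ξ => DnoidalPeak.peak_neg L _ ω Z ξ⟩
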